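/- **Theorem.** For $N\ge 1$ and $p\in[0,1]$ let $\mathbb P_{N,p}$ be the law of the Erdős–Rényi graph $G(N,p)$ on $N$ labelled vertices (each of the $\binom N2$ edges is present independently with probability $p$). For a graph $(V,\mathcal E)$ let $d_i$ be the degree of the vertex $i$, let $\pi_i=d_i/(2|\mathcal E|)$, and let $h_{ij}=\mathbb E_i(\tau_j)\in[0,\infty]$, where $\tau_j=\inf\{m>0: X_m=j\}$ and $(X_m)_{m\ge 0}$ is simple random walk on the graph started at $X_0=i$. The random target time of $j$ is $H_j=\sum_{i\in V}\pi_i h_{ij}$. Let $a_0>0$ and $\tilde a_0\ge 10$ be constants. Then there is a constant $C>0$ (depending on $a_0,\tilde a_0$ only, not on $N$) such that the following holds. Let $\xi=\xi_N$ satisfy $$1+a_0\le \xi_N\le \tilde a_0\log\log N\qquad\text{for all sufficiently large } N,$$ and let $p=p(N)\in[0,1]$, with $p(N)>0$ for all sufficiently large $N$, satisfy $$\frac{(\log N)^{2C\xi_N}}{Np(N)}\longrightarrow 0\qquad (N\to\infty).$$ Then asymptotically almost surely $H_j=N(1+o(1))$ for all vertices $j$; that is, there is a deterministic sequence $\delta_N\to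 0$ such that $$\mathbb P_{N,p(N)}\bigl(\,N(1-\delta_N)\le H_j\le N(1+\delta_N)\ \text{ for every } j\in V\,\bigr)\longrightarrow 1\qquad (N\to\infty).$$ -/

import Mathlib

open MeasureTheory ProbabilityTheory Filter Topology
open scoped ENNReal

noncomputable section

namespace RandomWalkGraph

variable {V : Type*} [Fintype V]

/-- The distribution of one step of simple random walk on `G` from `v`: uniform on the neighbours
of `v`. (At an isolated vertex, where no step is possible, the walk stays put by convention.) -/
def step (G : SimpleGraph V) (v : V) : PMF V :=
  open Classical in
  if h : (G.neighborFinset v).Nonempty then PMF.uniformOfFinset (G.neighborFinset v) h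
  else PMF.pure v

variable [MeasurableSpace V] [DiscreteMeasurableSpace V]

/-- The transition kernel of simple random walk on `G`. -/
def stepKernel (G : SimpleGraph V) : Kernel V V where
  toFun v := (step G v).toMeasure
  measurable' := .of_discrete

instance (G : SimpleGraph V) : IsMarkovKernel (stepKernel G) :=
  ⟨fun v => PMF.toMeasure.isProbabilityMeasure (step G v)⟩

/-- The law `ℙ_i` on `ℕ → V` of simple random walk `(X_n)` on `G` started at `X_0 = i`: given the
past `X_0, …, X_n`, the next position `X_{n+1}` is distributed according to the step distribution
from `X_n`. -/
def walkLaw (G : SimpleGraph V) (i : V) : Measure (ℕ → V) :=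
  Kernel.traj (X := fun _ : ℕ => V)
    (fun n => (stepKernel G).comap
      (fun x : (Π _ : Finset.Iic n, V) => x ⟨n, Finset.mem_Iic.2 le_rfl⟩) (measurable_pi_apply _))
    0 (fun _ => i)

/-- `τ_j = inf {m > 0 : X_m = j}`, with value `∞` if `j` is never visited at a positive time. -/
def hitTime (j : V) (X : ℕ → V) : ℝ≥0∞ :=
  ⨅ (m : ℕ) (_ : 0 < m ∧ X m = j), (m : ℝ≥0∞)

/-- The hitting time `h_{ij} = 𝔼_i τ_j` of simple random walk on `G`. -/
def meanHitTime (G : SimpleGraph V) (i j : V) : ℝ≥0∞ :=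
  ∫⁻ X, hitTime j X ∂(walkLaw G i)

/-- `π_i = d_i / (2 |E|)`. -/
def statDist (G : SimpleGraph V) (i : V) : ℝ≥0∞ :=
  open Classical in (G.degree i : ℝ≥0∞) / (2 * (G.edgeFinset.card : ℝ≥0∞))

/-- The random target time `H_j = ∑_i π_i h_{ij}`. -/
def targetTime (G : SimpleGraph V) (j : V) : ℝ≥0∞ :=
  ∑ i, statDist G i * meanHitTime G i j

end RandomWalkGraph

end

/-! The mean hitting times of `j` solve a linear equation for the operator I − P. Here P = d⁻¹A is
the transition operator, self-adjoint in ℓ²(d). If P has norm at most ε on functions of weighted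
mean zero, then I − P is nearly the identity there. Testing the equation against its solution then
gives H_j = (1 + O(ε)) S / d_j, up to an additive 1, where S = ∑ d_i (`sum_le_of_subsolution`,
`le_sum_of_solution`, `targetTime_bounds`). When all degrees are close to Np, the ratio S / d_j is
close to N.

Both the gap and the regularity of the degrees follow from `Concentrated`: the centered adjacency
matrix M has small operator norm and small row sums relative to Np. This is proved by high moments.
In E tr M^{2k} only closed walks repeating every edge survive; they use at most k edges, hence at
most k + 1 vertices, so the moment is at most about k^{2k} N (Np)^k. The same count bounds the row
sums.

With k ≈ log N, Markov's inequality at scale η = 1 / log N fails with probability O(1/N) once Np ≥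
(log N)^8. The choice C = 4 supplies this lower bound. -/

noncomputable section

namespace RandomWalkGraph

/-! ### Hitting times as sums of avoidance indicators -/

/-- The walk avoids `j` at the times `1, …, m`. -/
def avoids {V : Type*} (j : V) (m : ℕ) : Set (ℕ → V) := {X | ∀ s, 0 < s → s ≤ m → X s ≠ j}

lemma measurableSet_avoids {V : Type*} [MeasurableSpace V] [DiscreteMeasurableSpace V]
    (j : V) (m : ℕ) : MeasurableSet (avoids j m) := by
  have : avoids j m = ⋂ (s : ℕ) (_ : 0 < s) (_ : s ≤ m), (fun X : ℕ → V => X s) ⁻¹' {j}ᶜ := by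
    ext X; simp [avoids]
  rw [this]
  exact .iInter fun s => .iInter fun _ => .iInter fun _ => measurable_pi_apply s .of_discrete

/-- Tail-sum formula: τ_j counts the m ≥ 0 with τ_j > m. Both sides are infinite if `j` is never
hit. -/
lemma hitTime_eq_tsum {V : Type*} (j : V) (X : ℕ → V) :
    hitTime j X = ∑' m, (avoids j m).indicator (fun _ => (1 : ℝ≥0∞)) X := by
  classical
  by_cases h : ∃ m, 0 < m ∧ X m = j
  · have h1 : hitTime j X = (Nat.find h : ℝ≥0∞) := by
      refine le_antisymm (iInf₂_le (Nat.find h) (Nat.find_spec h)) (le_iInf₂ fun m hm => ?_)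
      exact_mod_cast Nat.find_min' h hm
    have h2 : ∀ m, (avoids j m).indicator (fun _ => (1 : ℝ≥0∞)) X =
        if m ∈ Finset.range (Nat.find h) then 1 else 0 := by
      intro m
      rw [Set.indicator_apply]
      congr 1
      simp only [avoids, Set.mem_ofPred_eq, Finset.mem_range, eq_iff_iff, Nat.lt_find_iff, not_and]
      exact ⟨fun H s hs h0 => H s h0 hs, fun H s h0 hs => H s hs h0⟩
    rw [h1, tsum_congr h2, tsum_eq_sum (s := Finset.range (Nat.find h))]
    · rw [Finset.sum_congr rfl fun m hm => if_pos hm]; simp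
    · intro b hb; simp only [if_neg hb]
  · push Not at h
    have h1 : hitTime j X = ⊤ := by
      simp only [hitTime, iInf_eq_top]
      exact fun m hm => (h m hm.1 hm.2).elim
    have h2 : ∀ m, (avoids j m).indicator (fun _ => (1 : ℝ≥0∞)) X = 1 := by
      intro m
      exact Set.indicator_of_mem (show X ∈ avoids j m from fun s hs _ => h s hs) _
    rw [h1, tsum_congr h2, ENNReal.tsum_const_eq_top_of_ne_zero one_ne_zero]

/-! ### Avoidance probabilities through the killed transition operator -/

section Walk
variable {V : Type*} [Fintype V]

/-- The transition operator of simple random walk killed on its visits to `j`. -/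
def killedOp (G : SimpleGraph V) (j : V) (f : V → ℝ≥0∞) (i : V) : ℝ≥0∞ :=
  open Classical in ∑ k, step G i k * (if k = j then 0 else f k)

variable [MeasurableSpace V] [DiscreteMeasurableSpace V]

/-- The transition kernels, depending on the whole past, from which `walkLaw` is built. -/
abbrev pastKernel (G : SimpleGraph V) (n : ℕ) : Kernel (Π _ : Finset.Iic n, V) V :=
  (stepKernel G).comap (fun x : (Π _ : Finset.Iic n, V) => x ⟨n, Finset.mem_Iic.2 le_rfl⟩)
    (measurable_pi_apply _)

lemma lintegral_step (G : SimpleGraph V) (i : V) (f : V → ℝ≥0∞) :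
    ∫⁻ k, f k ∂(step G i).toMeasure = ∑ k, step G i k * f k := by
  rw [lintegral_fintype]
  refine Finset.sum_congr rfl fun k _ => ?_
  rw [PMF.toMeasure_apply_singleton _ _ (.singleton k), mul_comm]

/-- Markov property at time m: conditionally on the path up to m, only the last step is integrated.
Avoiding `j` at time m + 1 is absorbed into the killing. Iterating down to time 0 gives the powers
of `killedOp`. -/
lemma lintegral_walkLaw_succ (G : SimpleGraph V) (i j : V) (m : ℕ) (f : V → ℝ≥0∞) :
    ∫⁻ X, (avoids j (m + 1)).indicator (fun X => f (X (m + 1))) X ∂(walkLaw G i) =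
      ∫⁻ X, (avoids j m).indicator (fun X => killedOp G j f (X m)) X ∂(walkLaw G i) := by
  classical
  let A : Set (Π _ : Finset.Iic m, V) := {x | ∀ s : Finset.Iic m, 0 < s.1 → x s ≠ j}
  have hA : ∀ X : ℕ → V, Preorder.frestrictLe (π := fun _ => V) m X ∈ A ↔ X ∈ avoids j m := by
    intro X
    constructor
    · intro H s hs hm
      exact H ⟨s, Finset.mem_Iic.2 hm⟩ hs
    · intro H s hs
      exact H s.1 hs (Finset.mem_Iic.1 s.2)
  have mA : MeasurableSet A := .of_discrete
  let f' : V → ℝ≥0∞ := fun k => if k = j then 0 else f k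
  let last : (Π _ : Finset.Iic m, V) → V := fun x => x ⟨m, Finset.mem_Iic.2 le_rfl⟩
  let F : (Π _ : Finset.Iic m, V) × (ℕ → V) → ℝ≥0∞ := fun z => A.indicator 1 z.1 * f' (z.2 (m + 1))
  have mF : Measurable F := by
    refine Measurable.mul ?_ ?_
    · exact (measurable_one.indicator mA).comp measurable_fst
    · exact (measurable_of_finite f').comp ((measurable_pi_apply (m + 1)).comp measurable_snd)
  have key := Kernel.partialTraj_compProd_traj (X := fun _ => V) (κ := pastKernel G) (Nat.zero_le m) (fun _ => i)
  have lhs : ∫⁻ X, (avoids j (m + 1)).indicator (fun X => f (X (m + 1))) X ∂(walkLaw G i) =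
      ∫⁻ z, F z ∂((walkLaw G i).map fun x => (Preorder.frestrictLe m x, x)) := by
    rw [lintegral_map mF (by fun_prop)]
    refine lintegral_congr fun X => ?_
    have hX : X ∈ avoids j (m + 1) ↔ X ∈ avoids j m ∧ X (m + 1) ≠ j := by
      constructor
      · exact fun H => ⟨fun s hs hm => H s hs (by omega), H _ (by omega) le_rfl⟩
      · rintro ⟨H1, H2⟩ s hs hm
        rcases Nat.lt_or_ge m s with h | h
        · obtain rfl : s = m + 1 := by omega
          exact H2
        · exact H1 s hs h
    simp only [F, f', Set.indicator_apply, hA, hX]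
    by_cases h1 : X ∈ avoids j m <;> by_cases h2 : X (m + 1) = j <;> simp [h1, h2]
  rw [lhs]
  unfold walkLaw
  rw [← key, Measure.lintegral_compProd mF]
  have inner : ∀ x : (Π _ : Finset.Iic m, V),
      ∫⁻ X, F (x, X) ∂(Kernel.traj (pastKernel G) m x) =
        A.indicator (fun x => killedOp G j f (last x)) x := by
    intro x
    have h1 : ∫⁻ X : ℕ → V, f' (X (m + 1)) ∂(Kernel.traj (pastKernel G) m x) =
        killedOp G j f (last x) := by
      have h2 : ((Kernel.traj (pastKernel G) m).map (fun X : ℕ → V => X (m + 1))) x = pastKernel G m x := by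
        rw [Kernel.map_traj_succ_self]
      rw [Kernel.map_apply _ (by fun_prop)] at h2
      rw [← lintegral_map (f := f') (measurable_of_finite f') (by fun_prop), h2, Kernel.comap_apply]
      exact lintegral_step G _ f'
    simp only [F]
    have mf : Measurable fun X : ℕ → V => f' (X (m + 1)) :=
      (measurable_of_finite f').comp (measurable_pi_apply (m + 1))
    rw [lintegral_const_mul _ mf, h1]
    simp [Set.indicator_apply]
  rw [lintegral_congr inner, ← Kernel.traj_map_frestrictLe_apply,
    lintegral_map (measurable_of_finite _) (by fun_prop)]
  refine lintegral_congr fun X => ?_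
  simp only [Set.indicator_apply, hA]
  rfl

lemma lintegral_walkLaw_avoids (G : SimpleGraph V) (i j : V) (m : ℕ) (f : V → ℝ≥0∞) :
    ∫⁻ X, (avoids j m).indicator (fun X => f (X m)) X ∂(walkLaw G i) =
      (killedOp G j)^[m] f i := by
  induction m generalizing f with
  | zero =>
    have h0 : ∀ X : ℕ → V, X ∈ avoids j 0 := fun X s hs hm => by omega
    have h1 : (walkLaw G i).map (fun X => X 0) = Measure.dirac i := by
      have h2 := Kernel.traj_map_frestrictLe_apply (X := fun _ => V) (κ := pastKernel G) 0 0 (fun _ => i)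
      rw [Kernel.partialTraj_self, Kernel.id_apply] at h2
      have h3 : (fun X : ℕ → V => X 0) =
          (fun x : (Π _ : Finset.Iic 0, V) => x ⟨0, Finset.mem_Iic.2 le_rfl⟩) ∘
            Preorder.frestrictLe (π := fun _ => V) 0 := rfl
      rw [h3, ← Measure.map_map (by fun_prop) (by fun_prop)]
      unfold walkLaw
      rw [h2, Measure.map_dirac' (by fun_prop)]
    simp only [Set.indicator_of_mem (h0 _), Function.iterate_zero, id]
    rw [← lintegral_map (f := f) (measurable_of_finite f) (by fun_prop), h1, lintegral_dirac]
  | succ m ih => rw [lintegral_walkLaw_succ, ih, Function.iterate_succ_apply]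

lemma meanHitTime_eq_tsum (G : SimpleGraph V) (i j : V) :
    meanHitTime G i j = ∑' m, (killedOp G j)^[m] 1 i := by
  unfold meanHitTime
  simp_rw [hitTime_eq_tsum]
  rw [lintegral_tsum fun m => (measurable_const.indicator (measurableSet_avoids j m)).aemeasurable]
  exact tsum_congr fun m => lintegral_walkLaw_avoids G i j m 1

end Walk

/-! ### The hitting time equation under a spectral gap -/

section SpectralGap

/-- `W` is a symmetric matrix of edge weights with positive row sums `d`, and on functions `g`
orthogonal to the constants in `ℓ²(d)` the averaging operator `d⁻¹ W` has norm at most `ε`. -/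
structure HasSpectralGap {V : Type*} [Fintype V] (W : V → V → ℝ) (d : V → ℝ) (ε : ℝ) : Prop where
  symm : ∀ i k, W i k = W k i
  rowSum : ∀ i, ∑ k, W i k = d i
  pos : ∀ i, 0 < d i
  gap : ∀ g : V → ℝ, ∑ i, d i * g i = 0 →
    ∑ i, (∑ k, W i k * g k) ^ 2 / d i ≤ ε ^ 2 * ∑ i, d i * g i ^ 2

lemma sum_center_eq_zero {V : Type*} [Fintype V] {d : V → ℝ} (f : V → ℝ) (hS : ∑ i, d i ≠ 0) :
    ∑ i, d i * (f i - (∑ i, d i * f i) / ∑ i, d i) = 0 := by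
  simp_rw [mul_sub, Finset.sum_sub_distrib, ← Finset.sum_mul]
  field_simp
  ring

namespace HasSpectralGap

variable {V : Type*} [Fintype V] {W : V → V → ℝ} {d : V → ℝ} {ε : ℝ}

lemma sum_weighted (h : HasSpectralGap W d ε) (f : V → ℝ) :
    ∑ i, ∑ k, W i k * f k = ∑ i, d i * f i := by
  rw [Finset.sum_comm]
  refine Finset.sum_congr rfl fun k _ => ?_
  rw [← Finset.sum_mul, ← h.rowSum k]
  simp_rw [h.symm k]

/-- Cauchy–Schwarz in ℓ²(d), pairing √d · g with Wg / √d. -/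
lemma abs_pairing_le (h : HasSpectralGap W d ε) (hε : 0 ≤ ε) {g : V → ℝ}
    (hg : ∑ i, d i * g i = 0) :
    |∑ i, g i * ∑ k, W i k * g k| ≤ ε * ∑ i, d i * g i ^ 2 := by
  have h0 : 0 ≤ ∑ i, d i * g i ^ 2 :=
    Finset.sum_nonneg fun i _ => mul_nonneg (h.pos i).le (sq_nonneg _)
  refine abs_le_of_sq_le_sq ?_ (mul_nonneg hε h0)
  calc (∑ i, g i * ∑ k, W i k * g k) ^ 2
      ≤ (∑ i, d i * g i ^ 2) * ∑ i, (∑ k, W i k * g k) ^ 2 / d i := by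
        refine Finset.sum_sq_le_sum_mul_sum_of_sq_le_mul _ ?_ ?_ ?_
        · exact fun i _ => mul_nonneg (h.pos i).le (sq_nonneg _)
        · exact fun i _ => div_nonneg (sq_nonneg _) (h.pos i).le
        · intro i _
          have := (h.pos i).ne'
          exact le_of_eq (by field_simp)
    _ ≤ (∑ i, d i * g i ^ 2) * (ε ^ 2 * ∑ i, d i * g i ^ 2) :=
        mul_le_mul_of_nonneg_left (h.gap g hg) h0
    _ = _ := by ring

/-- Centering a function does not change its Dirichlet form. -/
lemma dirichlet_center (h : HasSpectralGap W d ε) (f : V → ℝ) (c : ℝ) :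
    ∑ i, (f i - c) * (d i * (f i - c) - ∑ k, W i k * (f k - c)) =
      ∑ i, f i * (d i * f i - ∑ k, W i k * f k) := by
  have h1 : ∀ i, d i * (f i - c) - ∑ k, W i k * (f k - c) = d i * f i - ∑ k, W i k * f k := by
    intro i
    simp_rw [mul_sub, Finset.sum_sub_distrib, ← Finset.sum_mul, h.rowSum]
    ring
  have h2 : ∑ i, (d i * f i - ∑ k, W i k * f k) = 0 := by
    rw [Finset.sum_sub_distrib, h.sum_weighted, sub_self]
  simp_rw [h1, sub_mul, Finset.sum_sub_distrib, ← Finset.mul_sum, h2]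
  ring

/-- Testing against f bounds its Dirichlet form by F = ∑ d f. By the gap the form is at least (1 −
ε)‖f − c‖², where c = F / S is the mean. Since f vanishes at `j`, that coordinate alone contributes
d_j c², so (1 − ε) d_j c² ≤ F = cS. An inequality suffices as hypothesis, so truncated hitting times
are admissible before finiteness is known. -/
lemma sum_le_of_subsolution (h : HasSpectralGap W d ε) (hε : 0 ≤ ε) (hε1 : ε < 1) {f : V → ℝ}
    {j : V} (hf : ∀ i, 0 ≤ f i) (hj : f j = 0)
    (hsub : ∀ i, i ≠ j → d i * f i ≤ d i + ∑ k, W i k * f k) :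
    (∑ i, d i * f i) * ((1 - ε) * d j) ≤ (∑ i, d i) ^ 2 := by
  have hSpos : 0 < ∑ i, d i := Finset.sum_pos (fun i _ => h.pos i) ⟨j, Finset.mem_univ j⟩
  set S := ∑ i, d i with hS
  set F := ∑ i, d i * f i with hF
  set c := F / S with hc
  have hF0 : 0 ≤ F := Finset.sum_nonneg fun i _ => mul_nonneg (h.pos i).le (hf i)
  have hg : ∑ i, d i * (f i - c) = 0 := sum_center_eq_zero f hSpos.ne'
  have h1 := h.dirichlet_center f c
  have h2 : ∑ i, f i * (d i * f i - ∑ k, W i k * f k) ≤ F := by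
    refine Finset.sum_le_sum fun i _ => ?_
    by_cases hij : i = j
    · simp [hij, hj]
    · nlinarith [hsub i hij, hf i]
  have h3 := (abs_le.1 (h.abs_pairing_le hε hg)).2
  have h4 : ∑ i, (f i - c) * (d i * (f i - c) - ∑ k, W i k * (f k - c)) =
      ∑ i, d i * (f i - c) ^ 2 - ∑ i, (f i - c) * ∑ k, W i k * (f k - c) := by
    rw [← Finset.sum_sub_distrib]
    exact Finset.sum_congr rfl fun i _ => by ring
  have h5 : d j * c ^ 2 ≤ ∑ i, d i * (f i - c) ^ 2 := by
    have := Finset.single_le_sum (f := fun i => d i * (f i - c) ^ 2)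
      (fun i _ => mul_nonneg (h.pos i).le (sq_nonneg _)) (Finset.mem_univ j)
    simpa [hj] using this
  have h6 : (1 - ε) * (d j * c ^ 2) ≤ F := by nlinarith
  have h7 : F = c * S := by rw [hc]; field_simp
  have hc0 : 0 ≤ c := div_nonneg hF0 hSpos.le
  rcases hc0.eq_or_lt with h0 | h0
  · rw [h7, ← h0]; nlinarith
  · have h8 : (1 - ε) * d j * c ≤ S := by
      refine le_of_mul_le_mul_left ?_ h0
      rw [h7] at h6
      linarith
    rw [h7]
    nlinarith

/-- Put g = f − c and φ = d(I − P)g. Off `j` the equation says φ = d, and ∑ φ = 0 forces φ_j = d_j −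
S. Hence ∑ φ² / d is exactly S² / d_j − S. This is ‖(I − P)g‖², while F = ⟨g, (I − P)g⟩, and the two
are comparable because P is small on g. -/
lemma le_sum_of_solution (h : HasSpectralGap W d ε) (hε : 0 ≤ ε) (hε1 : ε ≤ 1 / 2) {f : V → ℝ}
    {j : V} (hj : f j = 0) (hsol : ∀ i, i ≠ j → d i * f i = d i + ∑ k, W i k * f k) :
    (1 - ε) * ((∑ i, d i) ^ 2 / d j - ∑ i, d i) ≤ ∑ i, d i * f i := by
  classical
  have hSpos : 0 < ∑ i, d i := Finset.sum_pos (fun i _ => h.pos i) ⟨j, Finset.mem_univ j⟩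
  have hdj := h.pos j
  set S := ∑ i, d i with hS
  set F := ∑ i, d i * f i with hF
  set c := F / S with hc
  have hg : ∑ i, d i * (f i - c) = 0 := sum_center_eq_zero f hSpos.ne'
  set φ : V → ℝ := fun i => d i * f i - ∑ k, W i k * f k with hφ
  have hφne : ∀ i, i ≠ j → φ i = d i := fun i hi => by
    simp only [hφ, hsol i hi]; ring
  have hφsum : ∑ i, φ i = 0 := by
    simp only [hφ]
    rw [Finset.sum_sub_distrib, h.sum_weighted, sub_self]
  have hφj : φ j = d j - S := by
    rw [← Finset.add_sum_erase _ _ (Finset.mem_univ j)] at hφsum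
    have : S = d j + ∑ i ∈ Finset.univ.erase j, d i :=
      (Finset.add_sum_erase _ _ (Finset.mem_univ j)).symm
    rw [Finset.sum_congr rfl fun i hi => hφne i (Finset.ne_of_mem_erase hi)] at hφsum
    linarith
  have hnorm : ∑ i, φ i ^ 2 / d i = S ^ 2 / d j - S := by
    rw [← Finset.add_sum_erase _ _ (Finset.mem_univ j)]
    have h1 : S = d j + ∑ i ∈ Finset.univ.erase j, d i :=
      (Finset.add_sum_erase _ _ (Finset.mem_univ j)).symm
    have h2 : ∑ i ∈ Finset.univ.erase j, φ i ^ 2 / d i = S - d j := by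
      rw [h1, add_sub_cancel_left]
      refine Finset.sum_congr rfl fun i hi => ?_
      rw [hφne i (Finset.ne_of_mem_erase hi), sq, mul_div_assoc, div_self (h.pos i).ne', mul_one]
    rw [h2, hφj]
    field_simp
    ring
  have hφ' : ∀ i, φ i = d i * (f i - c) - ∑ k, W i k * (f k - c) := by
    intro i
    simp_rw [hφ, mul_sub, Finset.sum_sub_distrib, ← Finset.sum_mul, h.rowSum]
    ring
  set a := ∑ i, d i * (f i - c) ^ 2 with ha
  set b := ∑ i, (f i - c) * ∑ k, W i k * (f k - c) with hb
  set e := ∑ i, (∑ k, W i k * (f k - c)) ^ 2 / d i with he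
  have hF' : F = a - b := by
    have h1 : ∑ i, f i * φ i = F := by
      refine Finset.sum_congr rfl fun i _ => ?_
      by_cases hij : i = j
      · simp [hij, hj]
      · rw [hφne i hij, mul_comm]
    rw [← h1, ha, hb, ← h.dirichlet_center f c, ← Finset.sum_sub_distrib]
    exact Finset.sum_congr rfl fun i _ => by ring
  have hnorm' : ∑ i, φ i ^ 2 / d i = a - 2 * b + e := by
    rw [ha, hb, he, Finset.mul_sum, ← Finset.sum_sub_distrib, ← Finset.sum_add_distrib]
    refine Finset.sum_congr rfl fun i _ => ?_
    have := (h.pos i).ne'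
    rw [hφ' i]
    field_simp
    ring
  have hab := abs_le.1 (h.abs_pairing_le hε hg)
  have hee : e ≤ ε ^ 2 * a := h.gap _ hg
  have ha0 : 0 ≤ a := Finset.sum_nonneg fun i _ => mul_nonneg (h.pos i).le (sq_nonneg _)
  have hbl : -(ε * a) ≤ b := hab.1
  rw [← hnorm, hnorm', hF']
  -- The claim is (1 − ε)(a − 2b + e) ≤ a − b. Inserting e ≤ ε²a and b ≥ −εa leaves the slack ε²a(1
  -- + ε) of `h3`; ε ≤ 1/2 gives the sign of 1 − 2ε.
  have h1 : (1 - ε) * e ≤ (1 - ε) * (ε ^ 2 * a) := mul_le_mul_of_nonneg_left hee (by linarith)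
  have h2 : (1 - 2 * ε) * (-(ε * a)) ≤ (1 - 2 * ε) * b :=
    mul_le_mul_of_nonneg_left hbl (by linarith)
  have h3 : 0 ≤ ε ^ 2 * a * (1 + ε) := by positivity
  nlinarith

end HasSpectralGap
end SpectralGap

/-! ### Finiteness of hitting times and the target time of a graph with a gap -/

section TargetTime
open Classical
variable {V : Type*} [Fintype V]

lemma step_apply {G : SimpleGraph V} {i : V} (hi : 0 < G.degree i) (k : V) :
    step G i k = if G.Adj i k then (G.degree i : ℝ≥0∞)⁻¹ else 0 := by
  have h : (G.neighborFinset i).Nonempty := Finset.card_pos.1 hi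
  rw [step]
  simp only [h, dif_pos, PMF.uniformOfFinset_apply, SimpleGraph.mem_neighborFinset,
    SimpleGraph.card_neighborFinset_eq_degree]

lemma toReal_killedOp {G : SimpleGraph V} {i j : V} (hi : 0 < G.degree i) {f : V → ℝ≥0∞}
    (hf : ∀ k, k ≠ j → f k ≠ ⊤) :
    killedOp G j f i ≠ ⊤ ∧ (killedOp G j f i).toReal * G.degree i =
      ∑ k, (if G.Adj i k then (1 : ℝ) else 0) * (if k = j then 0 else (f k).toReal) := by
  have h1 : ∀ k ∈ Finset.univ, step G i k * (if k = j then 0 else f k) ≠ ⊤ := by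
    intro k _
    refine ENNReal.mul_ne_top (PMF.apply_ne_top _ _) ?_
    split_ifs with h
    · exact ENNReal.zero_ne_top
    · exact hf k h
  have hd : (G.degree i : ℝ) ≠ 0 := by exact_mod_cast hi.ne'
  refine ⟨ENNReal.sum_ne_top.2 h1, ?_⟩
  rw [killedOp, ENNReal.toReal_sum h1, Finset.sum_mul]
  refine Finset.sum_congr rfl fun k _ => ?_
  rw [step_apply hi, ENNReal.toReal_mul]
  split_ifs <;> simp
  field_simp

lemma killedOp_tsum (G : SimpleGraph V) (j i : V) (f : ℕ → V → ℝ≥0∞) :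
    killedOp G j (fun k => ∑' m, f m k) i = ∑' m, killedOp G j (f m) i := by
  unfold killedOp
  rw [Summable.tsum_finsetSum fun _ _ => ENNReal.summable]
  refine Finset.sum_congr rfl fun k _ => ?_
  rw [ENNReal.tsum_mul_left]
  split_ifs <;> simp

lemma killedOp_sum (G : SimpleGraph V) (j i : V) (f : ℕ → V → ℝ≥0∞) (n : ℕ) :
    killedOp G j (fun k => ∑ m ∈ Finset.range n, f m k) i =
      ∑ m ∈ Finset.range n, killedOp G j (f m) i := by
  unfold killedOp
  rw [Finset.sum_comm]
  refine Finset.sum_congr rfl fun k _ => ?_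
  rw [← Finset.mul_sum]
  split_ifs <;> simp

/-- The mean of `min(τ_j, n)` as a function of the starting point. -/
def truncHit (G : SimpleGraph V) (j : V) (n : ℕ) (i : V) : ℝ≥0∞ :=
  ∑ m ∈ Finset.range n, (killedOp G j)^[m] 1 i

lemma truncHit_succ (G : SimpleGraph V) (j : V) (n : ℕ) (i : V) :
    truncHit G j (n + 1) i = 1 + killedOp G j (truncHit G j n) i := by
  rw [truncHit, Finset.sum_range_succ', add_comm]
  congr 1
  refine Eq.trans ?_ (killedOp_sum G j i _ n).symm
  simp_rw [Function.iterate_succ_apply']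

lemma truncHit_le_succ (G : SimpleGraph V) (j : V) (n : ℕ) (i : V) :
    truncHit G j n i ≤ truncHit G j (n + 1) i := by
  rw [truncHit, truncHit, Finset.sum_range_succ]
  exact le_self_add

lemma truncHit_ne_top {G : SimpleGraph V} (hG : ∀ i, 0 < G.degree i) (j : V) (n : ℕ) (i : V) :
    truncHit G j n i ≠ ⊤ := by
  induction n generalizing i with
  | zero => simp [truncHit]
  | succ n ih =>
    rw [truncHit_succ]
    exact ENNReal.add_ne_top.2 ⟨ENNReal.one_ne_top, (toReal_killedOp (hG i) fun k _ => ih k).1⟩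

/-- The spectral gap of simple random walk on `G`. -/
abbrev WalkGap (G : SimpleGraph V) (ε : ℝ) : Prop :=
  HasSpectralGap (fun i k => if G.Adj i k then (1 : ℝ) else 0) (fun i => (G.degree i : ℝ)) ε

lemma WalkGap.degree_pos {G : SimpleGraph V} {ε : ℝ} (h : WalkGap G ε) (i : V) :
    0 < G.degree i := by exact_mod_cast h.pos i

lemma statDist_eq {G : SimpleGraph V} (hS : 0 < ∑ k, (G.degree k : ℝ)) (i : V) :
    statDist G i = ENNReal.ofReal (G.degree i / ∑ k, (G.degree k : ℝ)) := by
  have h := G.sum_degrees_eq_twice_card_edges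
  have h2 : (∑ k, (G.degree k : ℝ)) = ((2 * G.edgeFinset.card : ℕ) : ℝ) := by
    rw [← h, Nat.cast_sum]
  rw [ENNReal.ofReal_div_of_pos hS, h2, ENNReal.ofReal_natCast, ENNReal.ofReal_natCast, statDist]
  push_cast
  congr!

variable [MeasurableSpace V] [DiscreteMeasurableSpace V]

lemma meanHitTime_eq_one_add (G : SimpleGraph V) (i j : V) :
    meanHitTime G i j = 1 + killedOp G j (fun k => meanHitTime G k j) i := by
  simp_rw [meanHitTime_eq_tsum]
  rw [killedOp_tsum, tsum_eq_zero_add' ENNReal.summable]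
  simp_rw [Function.iterate_succ_apply']
  rfl

/-- Truncated means increase in n, so their one-step recursion makes them subsolutions, bounded
uniformly in n away from `j`. The mean return time to `j` is then finite by one further step. -/
lemma meanHitTime_ne_top {G : SimpleGraph V} {ε : ℝ} (h : WalkGap G ε) (hε : 0 ≤ ε) (hε1 : ε < 1)
    (i j : V) : meanHitTime G i j ≠ ⊤ := by
  have hne : ∀ k, k ≠ j → meanHitTime G k j ≠ ⊤ := by
    intro k hk
    set S : ℝ := ∑ i, (G.degree i : ℝ)
    set B : ℝ := S ^ 2 / ((1 - ε) * G.degree j)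
    have hdj : 0 < (1 - ε) * (G.degree j : ℝ) := mul_pos (by linarith) (h.pos j)
    have hbound : ∀ n, truncHit G j n k ≤ ENNReal.ofReal (B / G.degree k) := by
      intro n
      let f : V → ℝ := fun i => if i = j then 0 else (truncHit G j n i).toReal
      have hf0 : ∀ i, 0 ≤ f i := fun i => by
        simp only [f]; split_ifs
        · exact le_rfl
        · exact ENNReal.toReal_nonneg
      have key := h.sum_le_of_subsolution hε hε1 (f := f) (j := j) hf0 (by simp [f]) (by
        intro i hi
        have h1 := toReal_killedOp (j := j) (h.degree_pos i)
          fun k _ => truncHit_ne_top h.degree_pos j n k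
        have h2 := ENNReal.toReal_mono (truncHit_ne_top h.degree_pos j (n + 1) i)
          (truncHit_le_succ G j n i)
        rw [truncHit_succ, ENNReal.toReal_add ENNReal.one_ne_top h1.1, ENNReal.toReal_one] at h2
        have h3 := mul_le_mul_of_nonneg_right h2 (h.pos i).le
        simp only [f, if_neg hi]
        rw [← h1.2]
        linarith)
      have h4 : ∑ i, (G.degree i : ℝ) * f i ≤ B := by
        rw [le_div_iff₀ hdj]; exact key
      have h5 : (G.degree k : ℝ) * f k ≤ B :=
        (Finset.single_le_sum (f := fun i => (G.degree i : ℝ) * f i)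
          (fun i _ => mul_nonneg (h.pos i).le (hf0 i)) (Finset.mem_univ k)).trans h4
      rw [← ENNReal.ofReal_toReal (truncHit_ne_top h.degree_pos j n k)]
      refine ENNReal.ofReal_le_ofReal ?_
      rw [le_div_iff₀ (h.pos k), mul_comm]
      simpa [f, hk] using h5
    rw [meanHitTime_eq_tsum]
    refine ne_top_of_le_ne_top ENNReal.ofReal_ne_top
      (ENNReal.tsum_le_of_sum_range_le hbound)
  rw [meanHitTime_eq_one_add]
  exact ENNReal.add_ne_top.2 ⟨ENNReal.one_ne_top, (toReal_killedOp (h.degree_pos i) hne).1⟩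

/-- A spectral gap pins the random target time of `j` to the inverse of the stationary mass
of `j`. -/
lemma targetTime_bounds {G : SimpleGraph V} {ε : ℝ} (h : WalkGap G ε) (hε : 0 ≤ ε)
    (hε1 : ε ≤ 1 / 2) (j : V) :
    ENNReal.ofReal ((1 - ε) * ((∑ i, (G.degree i : ℝ)) / G.degree j)) ≤ targetTime G j ∧
      targetTime G j ≤
        ENNReal.ofReal (1 + (∑ i, (G.degree i : ℝ)) / G.degree j / (1 - ε)) := by
  set S : ℝ := ∑ i, (G.degree i : ℝ) with hS
  have hSpos : 0 < S := Finset.sum_pos (fun i _ => h.pos i) ⟨j, Finset.mem_univ j⟩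
  have hdj : 0 < (G.degree j : ℝ) := h.pos j
  have hfin := fun i => meanHitTime_ne_top h hε (by linarith) i j
  let t : V → ℝ := fun i => (meanHitTime G i j).toReal
  let f : V → ℝ := fun i => if i = j then 0 else t i
  have ht : ∀ i, G.degree i * t i =
      G.degree i + ∑ k, (if G.Adj i k then (1 : ℝ) else 0) * f k := by
    intro i
    have h1 := toReal_killedOp (j := j) (h.degree_pos i) fun k _ => hfin k
    simp only [t]
    rw [meanHitTime_eq_one_add, ENNReal.toReal_add ENNReal.one_ne_top h1.1, ENNReal.toReal_one,
      mul_add, mul_one, mul_comm _ (ENNReal.toReal _), h1.2]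
  have hfj : f j = 0 := by simp [f]
  have hfne : ∀ i, i ≠ j → f i = t i := fun i hi => by simp [f, hi]
  have hsol : ∀ i, i ≠ j → (G.degree i : ℝ) * f i =
      G.degree i + ∑ k, (if G.Adj i k then (1 : ℝ) else 0) * f k := fun i hi => by
    rw [hfne i hi, ht i]
  have hf0 : ∀ i, 0 ≤ f i := fun i => by
    simp only [f, t]; split_ifs
    · exact le_rfl
    · exact ENNReal.toReal_nonneg
  set F : ℝ := ∑ i, (G.degree i : ℝ) * f i with hF
  have hlow : (1 - ε) * (S ^ 2 / G.degree j - S) ≤ F := h.le_sum_of_solution hε hε1 hfj hsol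
  have hupp : F * ((1 - ε) * G.degree j) ≤ S ^ 2 := h.sum_le_of_subsolution hε (by linarith) hf0 hfj
    fun i hi => (hsol i hi).le
  -- `f` vanishes at `j`, whereas `t j` is the mean return time. Summing the one-step equation over
  -- all i, including `j`, accounts for it: d_j t_j = S, which is Kac's formula.
  have hkac : ∑ i, (G.degree i : ℝ) * t i = F + S := by
    have h1 := h.sum_weighted f
    simp_rw [ht, Finset.sum_add_distrib, h1]
    rw [add_comm]
  have hterm : ∀ i, statDist G i * meanHitTime G i j =
      ENNReal.ofReal ((G.degree i : ℝ) / S * t i) := fun i => by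
    rw [ENNReal.ofReal_mul (div_nonneg (h.pos i).le hSpos.le), ENNReal.ofReal_toReal (hfin i),
      statDist_eq hSpos i]
  have hH : targetTime G j = ENNReal.ofReal ((F + S) / S) := by
    rw [targetTime, Finset.sum_congr rfl fun i _ => hterm i, ← ENNReal.ofReal_sum_of_nonneg, ← hkac,
      Finset.sum_div]
    · simp_rw [mul_div_right_comm]
    · exact fun i _ => mul_nonneg (div_nonneg (h.pos i).le hSpos.le) ENNReal.toReal_nonneg
  rw [hH]
  have hFS : (F + S) / S = 1 + F / S := by field_simp; ring
  constructor
  · refine ENNReal.ofReal_le_ofReal ?_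
    have : (1 - ε) * (S / G.degree j - 1) ≤ F / S := by
      rw [le_div_iff₀ hSpos]
      refine le_trans (le_of_eq ?_) hlow
      field_simp
    rw [hFS]
    linarith
  · refine ENNReal.ofReal_le_ofReal ?_
    rw [hFS]
    have hpos : 0 < (1 - ε) * (G.degree j : ℝ) := mul_pos (by linarith) hdj
    have : F / S ≤ S / G.degree j / (1 - ε) := by
      rw [div_div, mul_comm _ (1 - ε), div_le_div_iff₀ hSpos hpos, ← sq]
      exact hupp
    exact add_le_add_right this 1

end TargetTime

/-! ### Operator norm from even trace moments -/

section TraceNorm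
open Matrix
variable {V : Type*} [Fintype V]

lemma sq_dotProduct_le (x y : V → ℝ) : (x ⬝ᵥ y) ^ 2 ≤ (x ⬝ᵥ x) * (y ⬝ᵥ y) := by
  simp only [dotProduct, ← sq]
  exact Finset.sum_mul_sq_le_sq_mul_sq _ _ _

lemma dotProduct_self_nonneg_real (x : V → ℝ) : 0 ≤ x ⬝ᵥ x :=
  Finset.sum_nonneg fun i _ => mul_self_nonneg (x i)

lemma mulVec_dotProduct_comm {M : Matrix V V ℝ} (hM : M.IsSymm) (x y : V → ℝ) :
    (M *ᵥ x) ⬝ᵥ y = x ⬝ᵥ (M *ᵥ y) := by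
  rw [dotProduct_mulVec, ← mulVec_transpose, hM.eq]

/-- The operator norm is at most the Hilbert–Schmidt norm, whose square is tr B² for symmetric B. -/
lemma normSq_mulVec_le_trace {B : Matrix V V ℝ} (hB : B.IsSymm) (x : V → ℝ) :
    (B *ᵥ x) ⬝ᵥ (B *ᵥ x) ≤ (B * B).trace * (x ⬝ᵥ x) := by
  rw [trace, Finset.sum_mul]
  refine Finset.sum_le_sum fun i _ => ?_
  have h1 : (B * B).diag i = B i ⬝ᵥ B i := by
    simp only [diag_apply, mul_apply, dotProduct]
    exact Finset.sum_congr rfl fun k _ => by rw [hB.apply i k]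
  rw [h1, ← sq]
  exact sq_dotProduct_le _ _

variable [DecidableEq V]

/-- By symmetry and Cauchy–Schwarz, n ↦ ‖Mⁿx‖² is log-convex, so its successive ratios increase and
the first is at most their geometric mean. -/
lemma pow_normSq_mulVec_le {M : Matrix V V ℝ} (hM : M.IsSymm) (x : V → ℝ) (k : ℕ) :
    ((M *ᵥ x) ⬝ᵥ (M *ᵥ x)) ^ (k + 1) ≤
      ((M ^ (k + 1)) *ᵥ x) ⬝ᵥ ((M ^ (k + 1)) *ᵥ x) * (x ⬝ᵥ x) ^ k := by
  let a : ℕ → ℝ := fun n => ((M ^ n) *ᵥ x) ⬝ᵥ ((M ^ n) *ᵥ x)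
  have ha : ∀ n, 0 ≤ a n := fun n => dotProduct_self_nonneg_real _
  have hstep : ∀ n, (M ^ (n + 1)) *ᵥ x = M *ᵥ ((M ^ n) *ᵥ x) := fun n => by
    rw [mulVec_mulVec, pow_succ']
  have hlog : ∀ n, a (n + 1) ^ 2 ≤ a n * a (n + 2) := by
    intro n
    have h1 : a (n + 1) = ((M ^ n) *ᵥ x) ⬝ᵥ ((M ^ (n + 2)) *ᵥ x) := by
      simp only [a]
      rw [hstep (n + 1), hstep n, mulVec_dotProduct_comm hM]
    rw [h1]
    exact sq_dotProduct_le _ _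
  have hmul : ∀ n, a 1 * a n ≤ a 0 * a (n + 1) := by
    intro n
    induction n with
    | zero => rw [mul_comm]
    | succ n ih =>
      rcases (ha (n + 1)).eq_or_lt with h0 | h0
      · rw [← h0, mul_zero]; exact mul_nonneg (ha _) (ha _)
      · refine le_of_mul_le_mul_right ?_ h0
        calc a 1 * a (n + 1) * a (n + 1) = a 1 * a (n + 1) ^ 2 := by ring
          _ ≤ a 1 * (a n * a (n + 2)) := mul_le_mul_of_nonneg_left (hlog n) (ha 1)
          _ = (a 1 * a n) * a (n + 2) := by ring
          _ ≤ (a 0 * a (n + 1)) * a (n + 2) := mul_le_mul_of_nonneg_right ih (ha _)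
          _ = a 0 * a (n + 1 + 1) * a (n + 1) := by ring
  have hmain : ∀ n, a 1 ^ (n + 1) ≤ a (n + 1) * a 0 ^ n := by
    intro n
    induction n with
    | zero => simp
    | succ n ih =>
      calc a 1 ^ (n + 1 + 1) = a 1 ^ (n + 1) * a 1 := pow_succ _ _
        _ ≤ a (n + 1) * a 0 ^ n * a 1 := mul_le_mul_of_nonneg_right ih (ha 1)
        _ = (a 1 * a (n + 1)) * a 0 ^ n := by ring
        _ ≤ (a 0 * a (n + 1 + 1)) * a 0 ^ n :=
          mul_le_mul_of_nonneg_right (hmul _) (pow_nonneg (ha 0) n)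
        _ = a (n + 1 + 1) * a 0 ^ (n + 1) := by ring
  simpa [a] using hmain k

/-- A bound on an even trace moment of a symmetric matrix bounds its operator norm. -/
lemma normSq_mulVec_le_of_trace {M : Matrix V V ℝ} (hM : M.IsSymm) {k : ℕ} (hk : k ≠ 0) {B : ℝ}
    (htr : (M ^ (2 * k)).trace ≤ B ^ (2 * k)) (x : V → ℝ) :
    (M *ᵥ x) ⬝ᵥ (M *ᵥ x) ≤ B ^ 2 * (x ⬝ᵥ x) := by
  obtain ⟨k, rfl⟩ := Nat.exists_eq_succ_of_ne_zero hk
  have h0 := dotProduct_self_nonneg_real x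
  refine le_of_pow_le_pow_left₀ hk (mul_nonneg (sq_nonneg B) h0) ?_
  calc ((M *ᵥ x) ⬝ᵥ (M *ᵥ x)) ^ (k + 1)
      ≤ ((M ^ (k + 1)) *ᵥ x) ⬝ᵥ ((M ^ (k + 1)) *ᵥ x) * (x ⬝ᵥ x) ^ k := pow_normSq_mulVec_le hM x k
    _ ≤ (M ^ (2 * (k + 1))).trace * (x ⬝ᵥ x) * (x ⬝ᵥ x) ^ k := by
        refine mul_le_mul_of_nonneg_right ?_ (pow_nonneg h0 k)
        have := normSq_mulVec_le_trace (hM.pow (k + 1)) x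
        rwa [← pow_add, ← two_mul] at this
    _ ≤ B ^ (2 * (k + 1)) * (x ⬝ᵥ x) * (x ⬝ᵥ x) ^ k := by gcongr
    _ = (B ^ 2 * (x ⬝ᵥ x)) ^ (k + 1) := by rw [mul_pow, ← pow_mul]; ring

end TraceNorm

/-! ### From concentration of the adjacency matrix to the target time -/

section Concentrated
open Classical
variable {V : Type*} [Fintype V]

/-- The adjacency matrix centered at the mean `p` of its off-diagonal entries. -/
def centeredAdj {V : Type*} (p : ℝ) (G : SimpleGraph V) : Matrix V V ℝ :=
  fun i k => if i = k then 0 else (if G.Adj i k then 1 else 0) - p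

lemma centeredAdj_isSymm {V : Type*} (p : ℝ) (G : SimpleGraph V) : (centeredAdj p G).IsSymm := by
  ext i k
  simp only [Matrix.transpose_apply, centeredAdj, eq_comm (a := k), G.adj_comm k]

/-- The decomposition A = M + p(J − I), with J the all-ones matrix. -/
lemma sum_adj_mul (p : ℝ) (G : SimpleGraph V) (g : V → ℝ) (i : V) :
    ∑ k, (if G.Adj i k then (1 : ℝ) else 0) * g k =
      (centeredAdj p G).mulVec g i + p * ∑ k, g k - p * g i := by
  have h : p * g i = ∑ k, if i = k then p * g k else 0 := by simp
  rw [h, Matrix.mulVec, dotProduct, Finset.mul_sum, ← Finset.sum_add_distrib,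
    ← Finset.sum_sub_distrib]
  refine Finset.sum_congr rfl fun k _ => ?_
  by_cases hik : i = k
  · subst hik; simp [centeredAdj]
  · simp only [centeredAdj, if_neg hik]; ring

lemma degree_eq_sum (G : SimpleGraph V) (i : V) :
    (G.degree i : ℝ) = ∑ k, if G.Adj i k then (1 : ℝ) else 0 := by
  rw [← SimpleGraph.card_neighborFinset_eq_degree, SimpleGraph.neighborFinset_eq_filter]
  simp

/-- The centered adjacency matrix has norm and row sums at most `η p |V|`. -/
structure Concentrated (G : SimpleGraph V) (p η : ℝ) : Prop where
  normSq_le : ∀ x : V → ℝ, (centeredAdj p G).mulVec x ⬝ᵥ (centeredAdj p G).mulVec x ≤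
    (η * (Fintype.card V * p)) ^ 2 * (x ⬝ᵥ x)
  rowSum_le : ∀ i, |∑ k, centeredAdj p G i k| ≤ η * (Fintype.card V * p)

/-- The degrees are centered at (N − 1)p; since 1 ≤ ηN, the missing p fits into a second error ηNp.
-/
lemma Concentrated.abs_degree_sub_le {G : SimpleGraph V} {p η : ℝ} (h : Concentrated G p η)
    (hp : 0 ≤ p) (hN : 1 ≤ η * Fintype.card V) (i : V) :
    |(G.degree i : ℝ) - Fintype.card V * p| ≤ 2 * η * (Fintype.card V * p) := by
  have h1 := sum_adj_mul p G (fun _ => 1) i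
  simp only [mul_one, Matrix.mulVec, dotProduct, Finset.sum_const, Finset.card_univ,
    nsmul_eq_mul] at h1
  rw [degree_eq_sum, h1]
  have h2 := abs_le.1 (h.rowSum_le i)
  have h3 : p ≤ η * Fintype.card V * p := le_mul_of_one_le_left hp hN
  rw [abs_le]
  constructor <;> linarith [h2.1, h2.2]

/-- In Ag = Mg + pσ − pg, the first term is small by the norm bound and the last since p ≤ ηNp. The
plain sum σ = ∑ g need not vanish, but ∑ d g = 0 gives Dσ = ∑ (D − d_i) g_i, which is small because
the degrees are nearly constant. -/
lemma Concentrated.walkGap {G : SimpleGraph V} {p η : ℝ} (h : Concentrated G p η) (hp : 0 < p)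
    (hη1 : η ≤ 1 / 20) (hN : 1 ≤ η * Fintype.card V) : WalkGap G (10 * η) := by
  set N : ℝ := ((Fintype.card V : ℕ) : ℝ) with hNdef
  have hNpos : 0 < N := by
    by_contra hneg
    nlinarith
  set D : ℝ := N * p with hD
  have hDpos : 0 < D := mul_pos hNpos hp
  have hdeg := h.abs_degree_sub_le hp.le hN
  have hlow : ∀ i, 9 / 10 * D ≤ G.degree i := fun i => by
    have := (abs_le.1 (hdeg i)).1
    nlinarith
  refine ⟨fun i k => by simp only [G.adj_comm], fun i => (degree_eq_sum G i).symm,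
    fun i => lt_of_lt_of_le (by positivity) (hlow i), fun g hg => ?_⟩
  set T : ℝ := ∑ i, g i ^ 2 with hT
  have hT0 : 0 ≤ T := Finset.sum_nonneg fun i _ => sq_nonneg _
  set σ : ℝ := ∑ k, g k with hσ
  have hσle : σ ^ 2 ≤ 4 * η ^ 2 * N * T := by
    have h1 : D * σ = ∑ i, (D - G.degree i) * g i := by
      simp_rw [sub_mul, Finset.sum_sub_distrib, hg, ← Finset.mul_sum, sub_zero]
      rfl
    have h2 : (D * σ) ^ 2 ≤ (N * (2 * η * D) ^ 2) * T := by
      rw [h1]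
      refine (Finset.sum_mul_sq_le_sq_mul_sq _ _ _).trans (mul_le_mul_of_nonneg_right ?_ hT0)
      calc ∑ i, (D - (G.degree i : ℝ)) ^ 2 ≤ ∑ _i : V, (2 * η * D) ^ 2 := by
            refine Finset.sum_le_sum fun i _ => sq_le_sq' ?_ ?_
            · linarith [(abs_le.1 (hdeg i)).2]
            · linarith [(abs_le.1 (hdeg i)).1]
        _ = N * (2 * η * D) ^ 2 := by simp [hNdef]
    refine le_of_mul_le_mul_left ?_ (pow_pos hDpos 2)
    calc D ^ 2 * σ ^ 2 = (D * σ) ^ 2 := by ring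
      _ ≤ _ := h2
      _ = D ^ 2 * (4 * η ^ 2 * N * T) := by ring
  have hM : ∑ i, (centeredAdj p G).mulVec g i ^ 2 ≤ (η * D) ^ 2 * T := by
    have := h.normSq_le g
    simpa only [dotProduct, ← sq] using this
  have hp2 : p ^ 2 ≤ (η * D) ^ 2 := by
    have : p ≤ η * D := by
      calc p ≤ η * N * p := le_mul_of_one_le_left hp.le hN
        _ = η * D := by rw [hD]; ring
    exact pow_le_pow_left₀ hp.le this 2
  have hA : ∑ i, (∑ k, (if G.Adj i k then (1 : ℝ) else 0) * g k) ^ 2 ≤ 18 * (η * D) ^ 2 * T := by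
    calc ∑ i, (∑ k, (if G.Adj i k then (1 : ℝ) else 0) * g k) ^ 2
        ≤ ∑ i, 3 * ((centeredAdj p G).mulVec g i ^ 2 + (p * σ) ^ 2 + p ^ 2 * g i ^ 2) := by
          refine Finset.sum_le_sum fun i _ => ?_
          rw [sum_adj_mul p G g i]
          nlinarith [sq_nonneg ((centeredAdj p G).mulVec g i - p * σ),
            sq_nonneg ((centeredAdj p G).mulVec g i + p * g i), sq_nonneg (p * σ + p * g i)]
      _ = 3 * (∑ i, (centeredAdj p G).mulVec g i ^ 2 + N * (p * σ) ^ 2 + p ^ 2 * T) := by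
          simp only [← Finset.mul_sum, Finset.sum_add_distrib, Finset.sum_const, Finset.card_univ,
            nsmul_eq_mul]
          rfl
      _ ≤ 3 * ((η * D) ^ 2 * T + 4 * (η * D) ^ 2 * T + (η * D) ^ 2 * T) := by
          have h1 : N * (p * σ) ^ 2 ≤ 4 * (η * D) ^ 2 * T := by
            calc N * (p * σ) ^ 2 = N * p ^ 2 * σ ^ 2 := by ring
              _ ≤ N * p ^ 2 * (4 * η ^ 2 * N * T) :=
                mul_le_mul_of_nonneg_left hσle (by positivity)
              _ = _ := by rw [hD]; ring
          have h2 : p ^ 2 * T ≤ (η * D) ^ 2 * T := mul_le_mul_of_nonneg_right hp2 hT0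
          linarith
      _ = _ := by ring
  calc ∑ i, (∑ k, (if G.Adj i k then (1 : ℝ) else 0) * g k) ^ 2 / G.degree i
      ≤ ∑ i, (∑ k, (if G.Adj i k then (1 : ℝ) else 0) * g k) ^ 2 / (9 / 10 * D) := by
        refine Finset.sum_le_sum fun i _ => ?_
        exact div_le_div_of_nonneg_left (sq_nonneg _) (by positivity) (hlow i)
    _ ≤ 18 * (η * D) ^ 2 * T / (9 / 10 * D) := by
        rw [← Finset.sum_div]
        exact div_le_div_of_nonneg_right hA (by positivity)
    _ = 20 * η ^ 2 * (D * T) := by field_simp; ring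
    _ ≤ (10 * η) ^ 2 * (9 / 10 * D * T) := by
        have : 0 ≤ η ^ 2 * (D * T) := by positivity
        nlinarith
    _ ≤ (10 * η) ^ 2 * ∑ i, G.degree i * g i ^ 2 := by
        refine mul_le_mul_of_nonneg_left ?_ (sq_nonneg _)
        rw [hT, Finset.mul_sum]
        exact Finset.sum_le_sum fun i _ => mul_le_mul_of_nonneg_right (hlow i) (sq_nonneg _)

lemma Concentrated.targetTime_bounds [MeasurableSpace V] [DiscreteMeasurableSpace V]
    {G : SimpleGraph V} {p η : ℝ} (h : Concentrated G p η) (hp : 0 < p)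
    (hη : 0 ≤ η) (hη1 : η ≤ 1 / 20) (hN : 1 ≤ η * Fintype.card V) (j : V) :
    ENNReal.ofReal (Fintype.card V * (1 - 40 * η)) ≤ targetTime G j ∧
      targetTime G j ≤ ENNReal.ofReal (Fintype.card V * (1 + 40 * η)) := by
  have hgap := h.walkGap hp hη1 hN
  have hb := RandomWalkGraph.targetTime_bounds hgap (by positivity) (by linarith) j
  have hdeg := fun i => abs_le.1 (h.abs_degree_sub_le hp.le hN i)
  set N : ℝ := ((Fintype.card V : ℕ) : ℝ) with hNdef
  have hNpos : 0 < N := by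
    by_contra hneg
    nlinarith
  set D : ℝ := N * p with hD
  have hDpos : 0 < D := mul_pos hNpos hp
  set S : ℝ := ∑ i, (G.degree i : ℝ) with hS
  have hd : 0 < (G.degree j : ℝ) := hgap.pos j
  have hSle : S ≤ N * ((1 + 2 * η) * D) := by
    calc S ≤ ∑ _i : V, (1 + 2 * η) * D :=
          Finset.sum_le_sum fun i _ => by linarith [(hdeg i).2]
      _ = _ := by simp [hNdef]
  have hSge : N * ((1 - 2 * η) * D) ≤ S := by
    calc N * ((1 - 2 * η) * D) = ∑ _i : V, (1 - 2 * η) * D := by simp [hNdef]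
      _ ≤ S := Finset.sum_le_sum fun i _ => by linarith [(hdeg i).1]
  have hND : 0 < N * D := mul_pos hNpos hDpos
  have hdl := (hdeg j).1
  have hdu := (hdeg j).2
  refine ⟨le_trans (ENNReal.ofReal_le_ofReal ?_) hb.1, hb.2.trans (ENNReal.ofReal_le_ofReal ?_)⟩
  · rw [← mul_div_assoc, le_div_iff₀ hd]
    rcases le_or_gt (1 - 40 * η) 0 with hneg | hposi
    · have h1 : N * (1 - 40 * η) * G.degree j ≤ 0 :=
        mul_nonpos_of_nonpos_of_nonneg (mul_nonpos_of_nonneg_of_nonpos hNpos.le hneg) hd.le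
      have h2 : 0 ≤ (1 - 10 * η) * S :=
        mul_nonneg (by linarith) (le_trans (by nlinarith) hSge)
      linarith
    · calc N * (1 - 40 * η) * G.degree j ≤ N * (1 - 40 * η) * ((1 + 2 * η) * D) :=
            mul_le_mul_of_nonneg_left (by linarith) (by positivity)
        _ = (1 - 40 * η) * (1 + 2 * η) * (N * D) := by ring
        _ ≤ (1 - 10 * η) * (1 - 2 * η) * (N * D) :=
            mul_le_mul_of_nonneg_right (by nlinarith) hND.le
        _ = (1 - 10 * η) * (N * ((1 - 2 * η) * D)) := by ring
        _ ≤ (1 - 10 * η) * S := mul_le_mul_of_nonneg_left hSge (by linarith)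
  -- The constant 39 leaves one ηN ≥ 1 to absorb the additive 1.
  · have h1 : S / G.degree j / (1 - 10 * η) ≤ N * (1 + 39 * η) := by
      rw [div_div, div_le_iff₀ (mul_pos hd (by linarith))]
      calc S ≤ N * ((1 + 2 * η) * D) := hSle
        _ = (1 + 2 * η) * (N * D) := by ring
        _ ≤ ((1 + 39 * η) * ((1 - 2 * η) * (1 - 10 * η))) * (N * D) := by
            refine mul_le_mul_of_nonneg_right ?_ hND.le
            have h2 : 1 - 12 * η ≤ (1 - 2 * η) * (1 - 10 * η) := by nlinarith
            have h3 := mul_le_mul_of_nonneg_left h2 (by linarith : 0 ≤ 1 + 39 * η)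
            nlinarith
        _ = N * (1 + 39 * η) * (((1 - 2 * η) * D) * (1 - 10 * η)) := by ring
        _ ≤ N * (1 + 39 * η) * (G.degree j * (1 - 10 * η)) := by
            refine mul_le_mul_of_nonneg_left ?_ (by positivity)
            exact mul_le_mul_of_nonneg_right (by linarith) (by linarith)
    linarith

end Concentrated

/-! ### Mixed moments of edge indicators -/

section EdgeMoments
open Classical
variable {V : Type*} [Fintype V]

instance : Finite (SimpleGraph V) := Finite.of_injective _ SimpleGraph.edgeSet_injective

/-- Together with finiteness, this makes every real function of the graph measurable and integrable.
-/
instance : MeasurableSingletonClass (SimpleGraph V) where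
  measurableSet_singleton G := by
    have h : ({G} : Set (SimpleGraph V)) = SimpleGraph.edgeSet ⁻¹' {G.edgeSet} := by
      ext H; simp
    rw [h]
    exact SimpleGraph.measurable_edgeSet (Set.toFinite _).measurableSet

/-- Edge indicators of the binomial random graph are independent. -/
lemma integral_binomialRandom_prod (p : unitInterval) (φ : Sym2 V → Prop → ℝ) :
    ∫ G, ∏ e, φ e (e ∈ G.edgeSet) ∂(SimpleGraph.binomialRandom V p) =
      ∏ e : Sym2 V, ((p : ℝ) * φ e (¬ e.IsDiag) + (1 - p) * φ e False) := by
  -- The Bernoulli coordinates include the diagonal pairs, which `fromEdgeSet` discards.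
  let ψ : Sym2 V → Prop → ℝ := fun e P => φ e (P ∧ ¬ e.IsDiag)
  have hmem : ∀ (s : Set (Sym2 V)) e,
      (e ∈ (SimpleGraph.fromEdgeSet s).edgeSet) = (e ∈ s ∧ ¬ e.IsDiag) := by
    intro s e
    simp [SimpleGraph.edgeSet_fromEdgeSet]
  have hfin : ∀ f : SimpleGraph V → ℝ, Measurable f := fun f => measurable_of_finite f
  have hset : Measurable fun q : Sym2 V → Prop => {e | q e} :=
    measurable_set_iff.2 fun e => measurable_pi_apply e
  rw [SimpleGraph.binomialRandom_eq_map, setBernoulli_eq_map,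
    Measure.map_map SimpleGraph.measurable_fromEdgeSet hset,
    integral_map (SimpleGraph.measurable_fromEdgeSet.comp hset).aemeasurable
      (hfin _).aestronglyMeasurable, Measure.infinitePi_eq_pi]
  have h1 : ∀ q : Sym2 V → Prop, ∏ e, φ e (e ∈ ((SimpleGraph.fromEdgeSet ∘
      fun q : Sym2 V → Prop => {e | q e}) q).edgeSet) = ∏ e, ψ e (q e) := by
    intro q
    refine Finset.prod_congr rfl fun e _ => ?_
    simp only [Function.comp_apply, hmem]
    rfl
  simp_rw [h1]
  rw [integral_fintype_prod_eq_prod]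
  refine Finset.prod_congr rfl fun e _ => ?_
  rw [integral_add_measure (.of_finite) (.of_finite), integral_smul_nnreal_measure,
    integral_smul_nnreal_measure, integral_dirac, integral_dirac]
  simp only [ψ, Set.mem_compl_iff, Sym2.mem_diagSet, and_self, false_and]
  rfl

/-- The centered indicator of the edge `e`. -/
def edgeVar {V : Type*} (p : ℝ) (e : Sym2 V) (G : SimpleGraph V) : ℝ :=
  if e.IsDiag then 0 else (if e ∈ G.edgeSet then 1 else 0) - p

lemma centeredAdj_eq_edgeVar {V : Type*} (p : ℝ) (G : SimpleGraph V) (i k : V) :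
    centeredAdj p G i k = edgeVar p s(i, k) G := by
  simp only [centeredAdj, edgeVar, Sym2.mk_isDiag_iff, SimpleGraph.mem_edgeSet]

variable {ι : Type*} [Fintype ι]

lemma abs_bernoulli_moment_le {p : ℝ} (hp : 0 ≤ p) (hp1 : p ≤ 1) {m : ℕ} (hm : 2 ≤ m) :
    |p * (1 - p) ^ m + (1 - p) * (0 - p) ^ m| ≤ p := by
  have h1 : (1 - p) ^ m ≤ (1 - p) ^ 2 := pow_le_pow_of_le_one (by linarith) (by linarith) hm
  have h2 : p ^ m ≤ p ^ 2 := pow_le_pow_of_le_one hp hp1 hm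
  calc |p * (1 - p) ^ m + (1 - p) * (0 - p) ^ m|
      ≤ |p * (1 - p) ^ m| + |(1 - p) * (0 - p) ^ m| := abs_add_le _ _
    _ = p * (1 - p) ^ m + (1 - p) * p ^ m := by
        rw [abs_mul, abs_mul, abs_pow, abs_pow, zero_sub, abs_neg, abs_of_nonneg hp,
          abs_of_nonneg (by linarith : 0 ≤ 1 - p)]
    _ ≤ p * (1 - p) ^ 2 + (1 - p) * p ^ 2 :=
        add_le_add (mul_le_mul_of_nonneg_left h1 hp)
          (mul_le_mul_of_nonneg_left h2 (by linarith))
    _ = p - p * p := by ring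
    _ ≤ p := by nlinarith

lemma two_mul_card_image_le {α : Type*} [DecidableEq α] (e : ι → α)
    (h : ∀ b ∈ Finset.univ.image e, 2 ≤ (Finset.univ.filter fun s => e s = b).card) :
    2 * (Finset.univ.image e).card ≤ Fintype.card ι := by
  rw [← Finset.card_univ, Finset.card_eq_sum_card_image e, mul_comm, ← smul_eq_mul]
  exact Finset.card_nsmul_le_sum _ _ _ h

/-- Mixed moments of the centered edge indicators: only products in which every edge is repeated
contribute, and each distinct edge costs a factor `p`. -/
lemma abs_integral_prod_edgeVar_le (p : unitInterval) (e : ι → Sym2 V) :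
    |∫ G, ∏ s, edgeVar p (e s) G ∂(SimpleGraph.binomialRandom V p)| ≤
      if 2 * (Finset.univ.image e).card ≤ Fintype.card ι
        then (p : ℝ) ^ (Finset.univ.image e).card else 0 := by
  have hp0 : (0 : ℝ) ≤ p := p.2.1
  have hp1 : (p : ℝ) ≤ 1 := p.2.2
  let m : Sym2 V → ℕ := fun b => (Finset.univ.filter fun s => e s = b).card
  let φ : Sym2 V → Prop → ℝ := fun b P => (if b.IsDiag then 0 else (if P then 1 else 0) - (p : ℝ)) ^ m b
  have hprod : ∀ G : SimpleGraph V, ∏ s, edgeVar p (e s) G = ∏ b, φ b (b ∈ G.edgeSet) := by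
    intro G
    rw [← Finset.prod_fiberwise Finset.univ e]
    refine Finset.prod_congr rfl fun b _ => ?_
    rw [Finset.prod_congr rfl (g := fun _ => edgeVar p b G)
      fun s hs => by rw [(Finset.mem_filter.1 hs).2], Finset.prod_const]
    simp only [φ, m, edgeVar]
    congr!
  simp_rw [hprod]
  rw [integral_binomialRandom_prod]
  have hm0 : ∀ b, b ∉ Finset.univ.image e → m b = 0 := by
    intro b hb
    refine Finset.card_eq_zero.2 (Finset.filter_eq_empty_iff.2 fun s _ hs => hb ?_)
    exact Finset.mem_image.2 ⟨s, Finset.mem_univ s, hs⟩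
  have hm1 : ∀ b ∈ Finset.univ.image e, 1 ≤ m b := by
    intro b hb
    obtain ⟨s, _, hs⟩ := Finset.mem_image.1 hb
    exact Finset.card_pos.2 ⟨s, Finset.mem_filter.2 ⟨Finset.mem_univ s, hs⟩⟩
  by_cases hrep : ∀ b ∈ Finset.univ.image e, 2 ≤ m b
  · rw [if_pos (two_mul_card_image_le e hrep), Finset.abs_prod]
    calc ∏ b, |(p : ℝ) * φ b (¬ b.IsDiag) + (1 - p) * φ b False|
        ≤ ∏ b : Sym2 V, if b ∈ Finset.univ.image e then (p : ℝ) else 1 := by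
          refine Finset.prod_le_prod (fun _ _ => abs_nonneg _) fun b _ => ?_
          split_ifs with hb
          · simp only [φ]
            by_cases hd : b.IsDiag
            · have : m b ≠ 0 := by have := hrep b hb; omega
              simp [hd, this, hp0]
            · simpa [hd] using abs_bernoulli_moment_le hp0 hp1 (hrep b hb)
          · simp [φ, hm0 b hb]
      _ = (p : ℝ) ^ (Finset.univ.image e).card := by
          rw [Finset.prod_ite_mem, Finset.univ_inter, Finset.prod_const]
  -- An edge occurring exactly once contributes its mean, which is zero.
  · push Not at hrep
    obtain ⟨b, hb, hb2⟩ := hrep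
    have hb1 : m b = 1 := by have := hm1 b hb; omega
    have hzero : (p : ℝ) * φ b (¬ b.IsDiag) + (1 - p) * φ b False = 0 := by
      simp only [φ, hb1, pow_one]
      by_cases hd : b.IsDiag
      · simp [hd]
      · simp [hd]; ring
    rw [Finset.prod_eq_zero (Finset.mem_univ b) hzero, abs_zero]
    split_ifs <;> positivity

/-- Functions with few values, weighted by `x` per value. -/
lemma sum_pow_card_image_le [DecidableEq ι] {x : ℝ} (hx : 0 ≤ x) (hNx : 1 ≤ Fintype.card V * x) (r : ℕ) :
    ∑ w : ι → V, (if (Finset.univ.image w).card ≤ r then x ^ (Finset.univ.image w).card else 0) ≤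
      (r + 1) * r ^ Fintype.card ι * (Fintype.card V * x) ^ r := by
  let f : ℕ → ℝ := fun v => if v ≤ r then r ^ Fintype.card ι * x ^ v else 0
  -- Functions are grouped by their image S: at most r^|ι| of them have a given image of size at
  -- most r. There are at most |V|^v images of size v, and |V|x ≥ 1 raises every exponent to r.
  have hfiber : ∀ S : Finset V, (∑ w : ι → V with Finset.univ.image w = S,
      if (Finset.univ.image w).card ≤ r then x ^ (Finset.univ.image w).card else 0) ≤
        f S.card := by
    intro S
    rw [Finset.sum_congr rfl (g := fun _ => if S.card ≤ r then x ^ S.card else 0)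
      fun w hw => by rw [(Finset.mem_filter.1 hw).2], Finset.sum_const, nsmul_eq_mul]
    simp only [f]
    split_ifs with hS
    · refine mul_le_mul_of_nonneg_right ?_ (pow_nonneg hx _)
      have h1 : (Finset.univ.filter fun w : ι → V => Finset.univ.image w = S) ⊆
          Fintype.piFinset fun _ => S := by
        intro w hw
        rw [Fintype.mem_piFinset]
        intro s
        rw [← (Finset.mem_filter.1 hw).2]
        exact Finset.mem_image_of_mem w (Finset.mem_univ s)
      have h2 := Finset.card_le_card h1
      rw [Fintype.card_piFinset, Finset.prod_const, Finset.card_univ] at h2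
      exact_mod_cast h2.trans (Nat.pow_le_pow_left hS _)
    · simp
  have hf0 : ∀ v, 0 ≤ f v := fun v => by simp only [f]; split_ifs <;> positivity
  rw [← Finset.sum_fiberwise Finset.univ (fun w : ι → V => Finset.univ.image w)]
  calc _ ≤ ∑ S : Finset V, f S.card := Finset.sum_le_sum fun S _ => hfiber S
    _ = ∑ v ∈ Finset.range (Fintype.card V + 1), (Fintype.card V).choose v * f v := by
        rw [← Finset.powerset_univ, Finset.sum_powerset_apply_card, Finset.card_univ]
        simp only [nsmul_eq_mul]
    _ ≤ ∑ v ∈ Finset.range (Fintype.card V + 1), if v ∈ Finset.range (r + 1) then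
          r ^ Fintype.card ι * (Fintype.card V * x) ^ r else 0 := by
        refine Finset.sum_le_sum fun v _ => ?_
        simp only [f, Finset.mem_range, Nat.lt_succ_iff]
        split_ifs with hv
        · have h1 : ((Fintype.card V).choose v : ℝ) ≤ (Fintype.card V : ℝ) ^ v := by
            exact_mod_cast Nat.choose_le_pow _ _
          calc ((Fintype.card V).choose v : ℝ) * (r ^ Fintype.card ι * x ^ v)
              ≤ (Fintype.card V : ℝ) ^ v * (r ^ Fintype.card ι * x ^ v) :=
                mul_le_mul_of_nonneg_right h1 (by positivity)
            _ = r ^ Fintype.card ι * (Fintype.card V * x) ^ v := by rw [mul_pow]; ring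
            _ ≤ _ := mul_le_mul_of_nonneg_left (pow_le_pow_right₀ hNx hv) (by positivity)
        · simp
    _ ≤ ∑ _v ∈ Finset.range (r + 1), r ^ Fintype.card ι * (Fintype.card V * x) ^ r := by
        rw [Finset.sum_ite_mem]
        exact Finset.sum_le_sum_of_subset_of_nonneg Finset.inter_subset_right
          fun _ _ _ => by positivity
    _ = _ := by rw [Finset.sum_const, Finset.card_range, nsmul_eq_mul]; push_cast; ring

end EdgeMoments

/-! ### Trace and row-sum moments by counting walks -/

section Moments
open Classical
variable {V : Type*} [Fintype V]

lemma pow_apply_eq_sum_walks (M : Matrix V V ℝ) (n : ℕ) (i k : V) :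
    (M ^ n) i k = ∑ w : Fin (n + 1) → V, if w 0 = i ∧ w (Fin.last n) = k then
      ∏ s : Fin n, M (w s.castSucc) (w s.succ) else 0 := by
  induction n generalizing i with
  | zero =>
    rw [← (Equiv.funUnique (Fin 1) V).symm.sum_comp]
    simp only [pow_zero, Matrix.one_apply, Finset.univ_eq_empty, Finset.prod_empty]
    by_cases hik : i = k
    · subst hik; simp
    · rw [if_neg hik]
      refine (Finset.sum_eq_zero fun a _ => if_neg ?_).symm
      rintro ⟨h1, h2⟩
      exact hik (h1.symm.trans h2)
  | succ n ih =>
    rw [pow_succ', Matrix.mul_apply]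
    simp_rw [ih]
    rw [← (Fin.consEquiv fun _ : Fin (n + 2) => V).sum_comp, Fintype.sum_prod_type]
    simp_rw [Fin.prod_univ_succ (n := n), Finset.mul_sum]
    rw [Finset.sum_comm, Finset.sum_eq_single i]
    · refine Finset.sum_congr rfl fun w _ => ?_
      rw [Finset.sum_eq_single (w 0)]
      · by_cases hk : w (Fin.last n) = k
        · have : (Fin.cons i w : Fin (n + 2) → V) (Fin.last (n + 1)) = k := by
            rw [← Fin.succ_last, Fin.cons_succ, hk]
          simp [Fin.consEquiv, hk, this]
        · have : (Fin.cons i w : Fin (n + 2) → V) (Fin.last (n + 1)) ≠ k := by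
            rwa [← Fin.succ_last, Fin.cons_succ]
          simp [Fin.consEquiv, hk]
      · intro l _ hl
        simp [Ne.symm hl]
      · simp
    · intro a _ ha
      refine Finset.sum_eq_zero fun w _ => ?_
      simp [Fin.consEquiv, ha]
    · simp

lemma trace_pow_eq_sum_walks (M : Matrix V V ℝ) (n : ℕ) :
    (M ^ n).trace = ∑ w : Fin (n + 1) → V, if w (Fin.last n) = w 0 then
      ∏ s : Fin n, M (w s.castSucc) (w s.succ) else 0 := by
  simp only [Matrix.trace, Matrix.diag_apply, pow_apply_eq_sum_walks]
  rw [Finset.sum_comm]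
  refine Finset.sum_congr rfl fun w _ => ?_
  rw [Finset.sum_eq_single (w 0)]
  · simp
  · intro i _ hi
    simp [Ne.symm hi]
  · simp

/-- A walk visits at most one vertex more than it uses edges. -/
lemma card_image_walk_le {α : Type*} [DecidableEq α] (n : ℕ) (w : Fin (n + 1) → α) :
    (Finset.univ.image w).card ≤
      (Finset.univ.image fun s : Fin n => s(w s.castSucc, w s.succ)).card + 1 := by
  induction n with
  | zero => exact Finset.card_image_le.trans (by simp)
  | succ n ih =>
    have hw : Finset.univ.image w = insert (w 0) (Finset.univ.image fun s : Fin (n + 1) => w s.succ) := by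
      rw [Fin.univ_succ, Finset.cons_eq_insert, Finset.image_insert, Finset.map_eq_image,
        Finset.image_image]
      rfl
    have he : (Finset.univ.image fun s : Fin (n + 1) => s(w s.castSucc, w s.succ)) =
        insert s(w 0, w 1) (Finset.univ.image fun s : Fin n => s(w s.succ.castSucc, w s.succ.succ)) := by
      rw [Fin.univ_succ, Finset.cons_eq_insert, Finset.image_insert, Finset.map_eq_image,
        Finset.image_image]
      rfl
    have hi := ih fun s => w s.succ
    simp only [Fin.succ_castSucc] at hi
    rw [hw, he]
    -- If the starting vertex is never revisited, the first edge is not reused either.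
    by_cases h0 : w 0 ∈ Finset.univ.image fun s : Fin (n + 1) => w s.succ
    · rw [Finset.insert_eq_of_mem h0]
      exact hi.trans (Nat.add_le_add_right (Finset.card_le_card (Finset.subset_insert _ _)) 1)
    · have h1 : s(w 0, w 1) ∉
          Finset.univ.image fun s : Fin n => s(w s.succ.castSucc, w s.succ.succ) := by
        intro h
        obtain ⟨s, _, hs⟩ := Finset.mem_image.1 h
        refine h0 (Finset.mem_image.2 ?_)
        have hmem : w 0 ∈ s(w s.succ.castSucc, w s.succ.succ) := by rw [hs]; simp
        rcases Sym2.mem_iff.1 hmem with h | h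
        · exact ⟨s.castSucc, Finset.mem_univ _, by rw [h, Fin.succ_castSucc]⟩
        · exact ⟨s.succ, Finset.mem_univ _, h.symm⟩
      rw [Finset.card_insert_of_notMem h0, Finset.card_insert_of_notMem h1]
      omega

/-- A contributing closed walk has at most k edges and k + 1 vertices. The extra factor p in `hterm`
turns p^edges into at most p^vertices, so that `sum_pow_card_image_le` applies with r = k + 1.
Cancelling this p from (Np)^(k+1) leaves N (Np)^k. -/
lemma integral_trace_pow_le (p : unitInterval) (hp : 0 < (p : ℝ))
    (hNp : 1 ≤ Fintype.card V * (p : ℝ)) (k : ℕ) :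
    ∫ G, ((centeredAdj p G : Matrix V V ℝ) ^ (2 * k)).trace ∂(SimpleGraph.binomialRandom V p) ≤
      (k + 2) * (k + 1) ^ (2 * k + 1) * Fintype.card V * (Fintype.card V * p) ^ k := by
  have hp1 : (p : ℝ) ≤ 1 := p.2.2
  simp_rw [trace_pow_eq_sum_walks]
  rw [integral_finsetSum _ fun w _ => .of_finite]
  have hterm : ∀ w : Fin (2 * k + 1) → V,
      p * ∫ G, (if w (Fin.last (2 * k)) = w 0 then ∏ s : Fin (2 * k),
        centeredAdj p G (w s.castSucc) (w s.succ) else 0) ∂(SimpleGraph.binomialRandom V p) ≤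
      if (Finset.univ.image w).card ≤ k + 1 then (p : ℝ) ^ (Finset.univ.image w).card else 0 := by
    intro w
    have hR : (0 : ℝ) ≤ if (Finset.univ.image w).card ≤ k + 1 then
        (p : ℝ) ^ (Finset.univ.image w).card else 0 := by split_ifs <;> positivity
    by_cases hw : w (Fin.last (2 * k)) = w 0
    · simp only [if_pos hw, centeredAdj_eq_edgeVar]
      let e : Fin (2 * k) → Sym2 V := fun s => s(w s.castSucc, w s.succ)
      have h1 := (le_abs_self _).trans (abs_integral_prod_edgeVar_le p e)
      have h2 : _ ≤ (Finset.univ.image e).card + 1 := card_image_walk_le _ w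
      rw [Fintype.card_fin] at h1
      split_ifs at h1 with hc
      · rw [if_pos (by omega)]
        calc _ ≤ (p : ℝ) * (p : ℝ) ^ (Finset.univ.image e).card :=
              mul_le_mul_of_nonneg_left h1 hp.le
          _ = (p : ℝ) ^ ((Finset.univ.image e).card + 1) := by ring
          _ ≤ _ := pow_le_pow_of_le_one hp.le hp1 h2
      · exact (mul_nonpos_of_nonneg_of_nonpos hp.le h1).trans hR
    · simpa only [if_neg hw, integral_zero, mul_zero] using hR
  refine le_of_mul_le_mul_left ?_ hp
  rw [Finset.mul_sum]
  refine (Finset.sum_le_sum fun w _ => hterm w).trans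
    ((sum_pow_card_image_le hp.le hNp (k + 1)).trans (le_of_eq ?_))
  rw [Fintype.card_fin]
  push_cast
  ring

/-- The edges form a star at i, so distinct edges correspond to distinct endpoints: at most k
vertices are free, and no factor N appears. -/
lemma integral_rowSum_pow_le (p : unitInterval) (hNp : 1 ≤ Fintype.card V * (p : ℝ)) (k : ℕ)
    (i : V) :
    ∫ G, (∑ l, centeredAdj p G i l) ^ (2 * k) ∂(SimpleGraph.binomialRandom V p) ≤
      (k + 1) * k ^ (2 * k) * (Fintype.card V * p) ^ k := by
  have hp : (0 : ℝ) ≤ p := p.2.1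
  simp_rw [Fintype.sum_pow]
  rw [integral_finsetSum _ fun w _ => .of_finite]
  refine (Finset.sum_le_sum fun w _ => ?_).trans
    ((sum_pow_card_image_le (ι := Fin (2 * k)) hp hNp k).trans (le_of_eq ?_))
  · simp only [centeredAdj_eq_edgeVar]
    refine (le_abs_self _).trans ((abs_integral_prod_edgeVar_le p fun s => s(i, w s)).trans ?_)
    have hcard : (Finset.univ.image fun s => s(i, w s)).card = (Finset.univ.image w).card := by
      have : (Finset.univ.image fun s => s(i, w s)) = (Finset.univ.image w).image fun l => s(i, l) := by
        rw [Finset.image_image]; rfl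
      rw [this]
      exact Finset.card_image_of_injective _ fun a b hab => Sym2.congr_right.1 hab
    rw [hcard, Fintype.card_fin]
    refine le_of_eq (if_congr ?_ rfl rfl)
    omega
  · rw [Fintype.card_fin]

end Moments

/-! ### Markov's inequality and the choice of the moment -/

section Concentration
open Classical
variable {V : Type*} [Fintype V]

lemma trace_pow_two_mul_nonneg {M : Matrix V V ℝ} (hM : M.IsSymm) (k : ℕ) :
    0 ≤ (M ^ (2 * k)).trace := by
  have h : (M ^ (2 * k)).trace = ∑ i, ∑ l, (M ^ k) i l ^ 2 := by
    rw [two_mul, pow_add, Matrix.trace]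
    refine Finset.sum_congr rfl fun i _ => ?_
    rw [Matrix.diag_apply, Matrix.mul_apply]
    exact Finset.sum_congr rfl fun l _ => by rw [(hM.pow k).apply i l, sq]
  rw [h]
  positivity

lemma measureReal_le_div_of_integral_le {f : SimpleGraph V → ℝ} (p : unitInterval)
    (hf : ∀ G, 0 ≤ f G) {I B : ℝ} (hB : 0 < B)
    (hI : ∫ G, f G ∂(SimpleGraph.binomialRandom V p) ≤ I) :
    (SimpleGraph.binomialRandom V p).real {G | B ≤ f G} ≤ I / B := by
  rw [le_div_iff₀ hB, mul_comm]
  exact (mul_meas_ge_le_integral_of_nonneg (.of_forall hf) .of_finite B).trans hI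

/-- The moment method: the binomial random graph is concentrated with high probability. -/
lemma measureReal_not_concentrated_le (p : unitInterval) (hp : 0 < (p : ℝ))
    (hNp : 1 ≤ Fintype.card V * (p : ℝ)) {η : ℝ} (hη : 0 < η) {k : ℕ} (hk : k ≠ 0) :
    (SimpleGraph.binomialRandom V p).real {G | ¬ Concentrated G (p : ℝ) η} ≤
      2 * ((k + 2) * (k + 1) * Fintype.card V *
        ((k + 1) ^ 2 / (η ^ 2 * (Fintype.card V * p))) ^ k) := by
  set N : ℝ := ((Fintype.card V : ℕ) : ℝ) with hN
  set D : ℝ := N * p with hD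
  have hDpos : 0 < D := by linarith
  have hN0 : 0 ≤ N := Nat.cast_nonneg _
  set μ := SimpleGraph.binomialRandom V p
  have hB : 0 < (η * D) ^ (2 * k) := by positivity
  set Q : ℝ := ((k + 1) ^ 2 / (η ^ 2 * D)) ^ k with hQ
  have hQeq : ((k : ℝ) + 1) ^ (2 * k) * D ^ k / (η * D) ^ (2 * k) = Q := by
    rw [hQ, pow_mul, pow_mul, ← mul_pow, ← div_pow]
    congr 1
    field_simp
  have htrace : μ.real {G | (η * D) ^ (2 * k) ≤
      ((centeredAdj (p : ℝ) G : Matrix V V ℝ) ^ (2 * k)).trace} ≤ (k + 2) * (k + 1) * N * Q := by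
    refine (measureReal_le_div_of_integral_le p
      (fun G => trace_pow_two_mul_nonneg (centeredAdj_isSymm _ G) k) hB
      (integral_trace_pow_le p hp hNp k)).trans (le_of_eq ?_)
    rw [← hQeq]
    ring
  have hrow : ∀ i, μ.real {G | (η * D) ^ (2 * k) ≤ (∑ l, centeredAdj (p : ℝ) G i l) ^ (2 * k)} ≤
      (k + 1) * Q := by
    intro i
    refine (measureReal_le_div_of_integral_le p (fun G => (even_two_mul k).pow_nonneg _) hB
      (integral_rowSum_pow_le p hNp k i)).trans ?_
    rw [← hQeq, mul_assoc, mul_div_assoc]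
    refine mul_le_mul_of_nonneg_left ?_ (by positivity)
    refine div_le_div_of_nonneg_right (mul_le_mul_of_nonneg_right ?_ (by positivity)) hB.le
    exact pow_le_pow_left₀ (by positivity) (by linarith) _
  have hsub : {G : SimpleGraph V | ¬ Concentrated G (p : ℝ) η} ⊆
      {G | (η * D) ^ (2 * k) ≤ ((centeredAdj (p : ℝ) G : Matrix V V ℝ) ^ (2 * k)).trace} ∪
      ⋃ i, {G | (η * D) ^ (2 * k) ≤ (∑ l, centeredAdj (p : ℝ) G i l) ^ (2 * k)} := by
    intro G hG
    by_contra hcon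
    simp only [Set.mem_union, Set.mem_ofPred_eq, Set.mem_iUnion, not_or, not_exists, not_le] at hcon
    refine hG ⟨normSq_mulVec_le_of_trace (centeredAdj_isSymm _ G) hk hcon.1.le, fun i => ?_⟩
    have h := (hcon.2 i).le
    rw [← (even_two_mul k).pow_abs] at h
    exact le_of_pow_le_pow_left₀ (by omega) (by positivity) h
  have hQ0 : 0 ≤ Q := by positivity
  calc μ.real {G | ¬ Concentrated G (p : ℝ) η}
      ≤ _ := measureReal_mono hsub
    _ ≤ _ := measureReal_union_le _ _
    _ ≤ (k + 2) * (k + 1) * N * Q + ∑ _i : V, (k + 1) * Q := by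
        refine add_le_add htrace ((measureReal_iUnion_fintype_le _).trans ?_)
        exact Finset.sum_le_sum fun i _ => hrow i
    _ = (k + 2) * (k + 1) * N * Q + (k + 1) * N * Q := by
        rw [Finset.sum_const, Finset.card_univ, nsmul_eq_mul, ← hN]; ring
    _ ≤ 2 * ((k + 2) * (k + 1) * N * Q) := by
        have h1 : 0 ≤ (k + 1) * N * Q := by positivity
        have h2 : 0 ≤ (k : ℝ) * ((k + 1) * N * Q) := by positivity
        nlinarith

/-- With mean degree at least `(log N)⁸`, concentration at scale `1 / log N` fails with
probability at most `16 / N`. -/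
lemma measureReal_not_concentrated_log_le {N : ℕ} (p : unitInterval) (hp : 0 < (p : ℝ))
    (hL : 20 ≤ Real.log N) (hLN : Real.log N ^ 2 ≤ N) (hD : Real.log N ^ 8 ≤ N * (p : ℝ)) :
    (SimpleGraph.binomialRandom (Fin N) p).real
      {G | ¬ Concentrated G (p : ℝ) (1 / Real.log N)} ≤ 16 / N := by
  set L := Real.log N with hLdef
  have hL0 : 0 < L := by linarith
  have hNpos : (0 : ℝ) < N := lt_of_lt_of_le (by positivity) hLN
  -- With k ≥ log N, a base of at most e⁻³ yields N⁻³, enough against the prefactor k²N. The base is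
  -- at most 4 / L⁴, as k + 1 ≤ 2L and Np ≥ L⁸.
  set k := ⌈L⌉₊ with hkdef
  have hk0 : k ≠ 0 := (Nat.ceil_pos.2 hL0).ne'
  have hkL : L ≤ k := Nat.le_ceil L
  have hkU : (k : ℝ) < L + 1 := Nat.ceil_lt_add_one hL0.le
  have hL8 : 0 < L ^ 8 := by positivity
  have hDpos : 0 < N * (p : ℝ) := lt_of_lt_of_le hL8 hD
  have h1L : 1 ≤ L ^ 8 := one_le_pow₀ (by linarith)
  have hmain := measureReal_not_concentrated_le (V := Fin N) p hp
    (by rw [Fintype.card_fin]; exact h1L.trans hD) (one_div_pos.2 hL0) hk0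
  rw [Fintype.card_fin] at hmain
  have hbase : ((k : ℝ) + 1) ^ 2 / ((1 / L) ^ 2 * (N * p)) ≤ Real.exp (-3) := by
    have h1 : ((k : ℝ) + 1) ^ 2 ≤ 4 * L ^ 2 := by nlinarith
    have h2 : L ^ 6 ≤ (1 / L) ^ 2 * (N * p) := by
      calc L ^ 6 = (1 / L) ^ 2 * L ^ 8 := by field_simp
        _ ≤ _ := mul_le_mul_of_nonneg_left hD (by positivity)
    have h3 : (4 * L ^ 2) / L ^ 6 ≤ 1 / 27 := by
      rw [div_le_div_iff₀ (by positivity) (by norm_num)]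
      have h4 : (20 : ℝ) ^ 4 ≤ L ^ 4 := pow_le_pow_left₀ (by norm_num) hL 4
      nlinarith [mul_le_mul_of_nonneg_left h4 (by positivity : 0 ≤ L ^ 2)]
    have h5 : (1 : ℝ) / 27 ≤ Real.exp (-3) := by
      have h6 : Real.exp 3 ≤ 27 := by
        have h7 : Real.exp 1 ≤ 3 := by linarith [Real.exp_one_lt_d9]
        calc Real.exp 3 = Real.exp 1 ^ 3 := by rw [← Real.exp_nat_mul]; norm_num
          _ ≤ 3 ^ 3 := pow_le_pow_left₀ (Real.exp_pos 1).le h7 3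
          _ = 27 := by norm_num
      rw [Real.exp_neg, ← one_div]
      exact one_div_le_one_div_of_le (Real.exp_pos 3) h6
    calc _ ≤ (4 * L ^ 2) / L ^ 6 := div_le_div₀ (by positivity) h1 (by positivity) h2
      _ ≤ _ := h3.trans h5
  have hQ : (((k : ℝ) + 1) ^ 2 / ((1 / L) ^ 2 * (N * p))) ^ k ≤ 1 / (N : ℝ) ^ 3 := by
    calc _ ≤ Real.exp (-3) ^ k := pow_le_pow_left₀ (by positivity) hbase k
      _ = Real.exp (k * -3) := by rw [Real.exp_nat_mul]
      _ ≤ Real.exp (-(3 * L)) := Real.exp_le_exp.2 (by linarith)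
      _ = 1 / (N : ℝ) ^ 3 := by
          rw [Real.exp_neg, ← one_div]
          congr 1
          have := Real.exp_nat_mul L 3
          rw [Real.exp_log hNpos] at this
          exact_mod_cast this
  refine hmain.trans ?_
  have hkk : ((k : ℝ) + 2) * (k + 1) ≤ 8 * N := by nlinarith
  calc (2 : ℝ) * (((k : ℝ) + 2) * (k + 1) * N * (((k : ℝ) + 1) ^ 2 / ((1 / L) ^ 2 * (N * p))) ^ k)
      ≤ 2 * ((8 * N) * N * (1 / (N : ℝ) ^ 3)) := by gcongr
    _ = 16 / (N : ℝ) := by field_simp; ring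

end Concentration

end RandomWalkGraph

end

/-! ### The asymptotic statement -/

theorem theorem2 (a₀ a₁ : ℝ) (ha₀ : 0 < a₀) (ha₁ : 10 ≤ a₁) :
    ∃ C : ℝ, 0 < C ∧
      ∀ (ξ : ℕ → ℝ) (p : ℕ → unitInterval),
        (∀ᶠ N : ℕ in atTop, 1 + a₀ ≤ ξ N ∧ ξ N ≤ a₁ * Real.log (Real.log (N : ℝ))) →
        (∀ᶠ N : ℕ in atTop, 0 < (p N : ℝ)) →
        Tendsto (fun N : ℕ => Real.log (N : ℝ) ^ (2 * C * ξ N) / ((N : ℝ) * (p N : ℝ)))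
          atTop (𝓝 0) →
        ∃ δ : ℕ → ℝ, Tendsto δ atTop (𝓝 0) ∧
          Tendsto
            (fun N : ℕ => SimpleGraph.binomialRandom (Fin N) (p N)
              {G : SimpleGraph (Fin N) | ∀ j : Fin N,
                ENNReal.ofReal ((N : ℝ) * (1 - δ N)) ≤ RandomWalkGraph.targetTime G j ∧
                RandomWalkGraph.targetTime G j ≤ ENNReal.ofReal ((N : ℝ) * (1 + δ N))})
            atTop (𝓝 1) := by
  -- C = 4 makes 2Cξ ≥ 8, since ξ ≥ 1. Once the ratio in the limit hypothesis is below 1, Np ≥ (log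
  -- N)^8.
  refine ⟨4, by norm_num, fun ξ p hξ hp hlim => ?_⟩
  have hlog : Tendsto (fun N : ℕ => Real.log (N : ℝ)) atTop atTop :=
    Real.tendsto_log_atTop.comp tendsto_natCast_atTop_atTop
  have hinv : Tendsto (fun N : ℕ => 1 / Real.log (N : ℝ)) atTop (𝓝 0) := by
    simp only [one_div]
    exact hlog.inv_tendsto_atTop
  -- δ = 40η with η = 1 / log N; η ≤ 1/20 requires log N ≥ 20 below.
  refine ⟨fun N => 40 * (1 / Real.log (N : ℝ)), by simpa using hinv.const_mul 40, ?_⟩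
  have hlogsq : ∀ᶠ N : ℕ in atTop, Real.log (N : ℝ) ^ 2 ≤ N := by
    have h := (isLittleO_log_rpow_atTop (r := 1 / 2) (by norm_num)).bound one_pos
    filter_upwards [tendsto_natCast_atTop_atTop.eventually h, eventually_ge_atTop 1] with N hN h1
    have hN0 : (0 : ℝ) ≤ N := Nat.cast_nonneg N
    rw [one_mul, Real.norm_eq_abs, Real.norm_eq_abs, abs_of_nonneg (Real.rpow_nonneg hN0 _),
      ← Real.sqrt_eq_rpow] at hN
    calc Real.log (N : ℝ) ^ 2 = |Real.log (N : ℝ)| ^ 2 := (sq_abs _).symm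
      _ ≤ Real.sqrt N ^ 2 := pow_le_pow_left₀ (abs_nonneg _) hN 2
      _ = N := Real.sq_sqrt hN0
  have hbound : ∀ᶠ N : ℕ in atTop, ENNReal.ofReal (1 - 16 / (N : ℝ)) ≤
      SimpleGraph.binomialRandom (Fin N) (p N)
        {G : SimpleGraph (Fin N) | ∀ j : Fin N,
          ENNReal.ofReal ((N : ℝ) * (1 - 40 * (1 / Real.log (N : ℝ)))) ≤
            RandomWalkGraph.targetTime G j ∧
          RandomWalkGraph.targetTime G j ≤
            ENNReal.ofReal ((N : ℝ) * (1 + 40 * (1 / Real.log (N : ℝ))))} := by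
    filter_upwards [hξ, hp, hlim.eventually (gt_mem_nhds one_pos), hlogsq,
      hlog.eventually_ge_atTop 20, eventually_ge_atTop 1] with N hξN hpN hlimN hsq hL hN1
    have hNpos : (0 : ℝ) < N := by exact_mod_cast hN1
    have hD : Real.log (N : ℝ) ^ 8 ≤ N * (p N : ℝ) := by
      rw [div_lt_one (mul_pos hNpos hpN)] at hlimN
      refine le_trans ?_ hlimN.le
      rw [← Real.rpow_natCast]
      refine Real.rpow_le_rpow_of_exponent_le (by linarith) ?_
      push_cast
      linarith [hξN.1]
    have hbad := RandomWalkGraph.measureReal_not_concentrated_log_le (p N) hpN hL hsq hD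
    set μ := SimpleGraph.binomialRandom (Fin N) (p N)
    have hgood : 1 - 16 / (N : ℝ) ≤ μ.real {G | RandomWalkGraph.Concentrated G (p N : ℝ)
        (1 / Real.log (N : ℝ))} := by
      have h := probReal_compl_eq_one_sub (μ := μ)
        (s := {G | RandomWalkGraph.Concentrated G (p N : ℝ) (1 / Real.log (N : ℝ))})
        (Set.toFinite _).measurableSet
      rw [Set.compl_ofPred] at h
      linarith
    refine (ENNReal.ofReal_le_of_le_toReal hgood).trans (measure_mono fun G hG j => ?_)
    have h := RandomWalkGraph.Concentrated.targetTime_bounds hG hpN (by positivity)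
      (one_div_le_one_div_of_le (by norm_num) hL)
      (by
        rw [Fintype.card_fin, one_div_mul_eq_div, one_le_div (by linarith)]
        nlinarith) j
    rwa [Fintype.card_fin] at h
  refine tendsto_of_tendsto_of_tendsto_of_le_of_le' ?_ tendsto_const_nhds hbound
    (.of_forall fun N => prob_le_one)
  have h : Tendsto (fun N : ℕ => 1 - 16 / (N : ℝ)) atTop (𝓝 1) := by
    simpa using (tendsto_const_nhds (x := (1 : ℝ))).sub
      (tendsto_const_div_atTop_nhds_zero_nat (16 : ℝ))
  simpa using ENNReal.tendsto_ofReal h
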